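/- **Setting.** An impression belongs to one of $m$ categories, to category $j$ with probability $p_j$ ($p_j \ge 0$, $\sum_j p_j = 1$). There are $n$ bidders; bidder $i$ has a known value $v_{ij} \ge 0$ for category $j$. A (pure) signaling scheme is a map $s$ from categories to signals; the support of a signal $S$ is $\{j : s(j) = S\}$. For a number $K \le m$, the scheme is $K$-anonymous if every signal that is used has a support of at least $K$ categories. After signal $S$ is broadcast, a second price auction is run in which each bidder $i$ bids the conditional expectation $\mathbf{E}[v_i \mid S]$. The revenue of the scheme is $$\mathrm{Rev}(s) = \sum_S \Pr[S]\cdot \operatorname{max2}_i\, \mathbf{E}[v_i \mid S] = \sum_S \operatorname{max2}_i \sum_{j : s(j) = S} p_j v_{ij},$$ where $\operatorname{max2}$ denotes the second highest value, counted with multiplicity ($0$ if $n < 2$). **Statement.** For $K$-anonymous signaling with known valuations there is a randomized, polynomial-time, $\frac{6e}{e-1}$-approximation algorithm for computing the revenue-maximizing signaling scheme. That is, there are a randomized algorithm and a polynomial $T$ such that on every instance $(m, n, K, (p_j), (v_{ij}))$ with $K \le m$ and rational $p_j$, $v_{ij}$, encoded in binary with input length $L$, the algorithm, whatever its coin tosses,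 halts within time $T(L)$ and outputs a $K$-anonymous scheme $s$, and $$\mathrm{Rev}(s^*) \le \frac{6e}{e-1}\,\mathbf{E}[\mathrm{Rev}(s)] \quad\text{for every $K$-anonymous scheme } s^*,$$ the expectation being over the coin tosses. (Time is measured on a random access machine with logarithmic cost and fair coin tosses, which agrees with Turing machine time up to polynomials.) -/

import Mathlib

namespace KAnonSignaling

/-! ### The signaling problem -/

/-- A known-valuation instance: `m` categories with prior `p`, `n` bidders, bidder `i` values
category `j` at `v i j`, and `K` is the anonymity parameter. `K ≤ m` says that some `K`-anonymous
scheme exists (namely the one with a single signal). The data are rational, so that an instance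
can be given to an algorithm. -/
structure Instance where
  m : ℕ
  n : ℕ
  K : ℕ
  p : Fin m → NNRat
  v : Fin n → Fin m → NNRat
  p_sum : ∑ j, p j = 1
  K_le : K ≤ m

/-- A (pure) signaling scheme: the map that sends each category to the name of the signal which is
broadcast for it. -/
abbrev Scheme (m : ℕ) := Fin m → ℕ

/-- The probability, `0` or `1`, that signal `S` is broadcast when the category is `j`. -/
def phi {m : ℕ} (s : Scheme m) (j : Fin m) (S : ℕ) : NNRat := if s j = S then 1 else 0

/-- The support of a signal: the categories for which it is broadcast. -/
def support {m : ℕ} (s : Scheme m) (S : ℕ) : Finset (Fin m) :=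
  Finset.univ.filter fun j => phi s j S = 1

/-- Every signal in use has a support of at least `K` categories. -/
def IsKAnonymous {m : ℕ} (K : ℕ) (s : Scheme m) : Prop :=
  ∀ S : ℕ, (support s S).Nonempty → K ≤ (support s S).card

/-- The second highest entry, counted with multiplicity, of a family of nonnegative numbers: the
largest value that is reached by two different entries; `0` if there are fewer than two entries. -/
def secondHighest {n : ℕ} (x : Fin n → NNRat) : NNRat :=
  (Finset.univ : Finset (Fin n)).offDiag.sup fun q => min (x q.1) (x q.2)

theorem secondHighest_eq {n : ℕ} (x : Fin n → NNRat) (i j : Fin n) (hij : i ≠ j)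
    (hi : ∀ k, x k ≤ x i) (hj : ∀ k, k ≠ i → x k ≤ x j) : secondHighest x = x j := by
  apply le_antisymm
  · refine Finset.sup_le fun q hq => ?_
    have hne : q.1 ≠ q.2 := (Finset.mem_offDiag.1 hq).2.2
    by_cases h : q.1 = i
    · exact (min_le_right _ _).trans (hj _ fun h' => hne (h.trans h'.symm))
    · exact (min_le_left _ _).trans (hj _ h)
  · have h := Finset.le_sup (f := fun q : Fin n × Fin n => min (x q.1) (x q.2))
      (show (i, j) ∈ (Finset.univ : Finset (Fin n)).offDiag by simp [hij])
    exact (le_min (hi j) le_rfl).trans h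

namespace Instance

variable (I : Instance)

/-- The probability that signal `S` is broadcast. -/
def signalProb (s : Scheme I.m) (S : ℕ) : NNRat := ∑ j, I.p j * phi s j S

/-- The probability of category `j` given that signal `S` is broadcast. -/
def posterior (s : Scheme I.m) (S : ℕ) (j : Fin I.m) : NNRat :=
  I.p j * phi s j S / I.signalProb s S

/-- The expected value of bidder `i` given that signal `S` is broadcast. -/
def expectedValue (s : Scheme I.m) (S : ℕ) (i : Fin I.n) : NNRat :=
  ∑ j, I.posterior s S j * I.v i j

/-- The expected revenue of truthful second price auctions that are run after each signal. A signal
of probability zero contributes nothing. -/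
def revenue (s : Scheme I.m) : NNRat :=
  ∑ S ∈ Finset.univ.image s, I.signalProb s S * secondHighest (I.expectedValue s S)

/-- The instance as a list of natural numbers: `m`, `n`, `K`, then numerator and denominator of
each `p j`, then those of each `v i j`, bidder by bidder. -/
def encode : List ℕ :=
  [I.m, I.n, I.K] ++
    (List.finRange I.m).flatMap (fun j => [(I.p j).num, (I.p j).den]) ++
    (List.finRange I.n).flatMap (fun i =>
      (List.finRange I.m).flatMap fun j => [(I.v i j).num, (I.v i j).den])

end Instance

/-! ### Randomized random access machines with logarithmic cost

Programs work on arrays of natural numbers (a program mentions finitely many of them, by fixed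
names), with computed indices. Every operation is charged for the binary lengths of all numbers
that take part in it, so that running times agree, up to polynomials, with those of Turing
machines. -/

inductive Op where
  | add
  | sub
  | mul
  | div
  | lt
  | eq

/-- Subtraction is truncated, division is rounded down, comparisons return `0` or `1`. -/
def Op.apply : Op → ℕ → ℕ → ℕ
  | .add, x, y => x + y
  | .sub, x, y => x - y
  | .mul, x, y => x * y
  | .div, x, y => x / y
  | .lt, x, y => if x < y then 1 else 0
  | .eq, x, y => if x = y then 1 else 0

inductive Expr where
  | const (c : ℕ)
  | read (a : ℕ) (idx : Expr)
  | op (o : Op) (e₁ e₂ : Expr)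

/-- `mem a k` is the content of cell `k` of array `a`. -/
abbrev Memory := ℕ → ℕ → ℕ

def Memory.write (mem : Memory) (a k x : ℕ) : Memory :=
  Function.update mem a (Function.update (mem a) k x)

def Expr.val (mem : Memory) : Expr → ℕ
  | .const c => c
  | .read a idx => mem a (idx.val mem)
  | .op o e₁ e₂ => o.apply (e₁.val mem) (e₂.val mem)

/-- The logarithmic cost of an evaluation; `Nat.size` is the number of binary digits. -/
def Expr.cost (mem : Memory) : Expr → ℕ
  | .const c => 1 + c.size
  | .read a idx => idx.cost mem + (1 + (idx.val mem).size + (mem a (idx.val mem)).size)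
  | .op o e₁ e₂ => e₁.cost mem + e₂.cost mem +
      (1 + (e₁.val mem).size + (e₂.val mem).size + (o.apply (e₁.val mem) (e₂.val mem)).size)

inductive Program where
  | skip
  | write (a : ℕ) (idx e : Expr)
  | flip (a : ℕ) (idx : Expr)
  | seq (P Q : Program)
  | ite (c : Expr) (P Q : Program)
  | while (c : Expr) (P : Program)

/-- The memory together with the coins that have not been used yet. -/
structure State where
  mem : Memory
  coins : List Bool

/-- `Exec P σ τ t`: started in `σ`, the program `P` halts in `τ`, at total cost `t`. A test succeeds
if its value is nonzero. `flip` moves the next coin to a cell; there is no execution if no coin is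
left. -/
inductive Exec : Program → State → State → ℕ → Prop
  | skip (σ : State) : Exec .skip σ σ 1
  | write (σ : State) (a : ℕ) (idx e : Expr) :
      Exec (.write a idx e) σ ⟨σ.mem.write a (idx.val σ.mem) (e.val σ.mem), σ.coins⟩
        (1 + idx.cost σ.mem + e.cost σ.mem)
  | flip (mem : Memory) (b : Bool) (cs : List Bool) (a : ℕ) (idx : Expr) :
      Exec (.flip a idx) ⟨mem, b :: cs⟩ ⟨mem.write a (idx.val mem) b.toNat, cs⟩
        (1 + idx.cost mem)
  | seq {P Q : Program} {σ τ ρ : State} {t u : ℕ} :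
      Exec P σ τ t → Exec Q τ ρ u → Exec (.seq P Q) σ ρ (t + u)
  | ite_true {c : Expr} {P Q : Program} {σ τ : State} {t : ℕ} :
      c.val σ.mem ≠ 0 → Exec P σ τ t → Exec (.ite c P Q) σ τ (1 + c.cost σ.mem + t)
  | ite_false {c : Expr} {P Q : Program} {σ τ : State} {t : ℕ} :
      c.val σ.mem = 0 → Exec Q σ τ t → Exec (.ite c P Q) σ τ (1 + c.cost σ.mem + t)
  | while_true {c : Expr} {P : Program} {σ τ ρ : State} {t u : ℕ} :
      c.val σ.mem ≠ 0 → Exec P σ τ t → Exec (.while c P) τ ρ u →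
        Exec (.while c P) σ ρ (1 + c.cost σ.mem + t + u)
  | while_false {c : Expr} {P : Program} {σ : State} :
      c.val σ.mem = 0 → Exec (.while c P) σ σ (1 + c.cost σ.mem)

/-- The input is in array `0`; all other cells contain `0`. -/
def initialState (x : List ℕ) (coins : List Bool) : State where
  mem a k := if a = 0 then x.getD k 0 else 0
  coins := coins

/-- The length of an input: each entry counts with its binary digits and a separator. -/
def inputSize (x : List ℕ) : ℕ := (x.map fun k => k.size + 1).sum

/-- On input `x` and coin tosses `r`, the program halts at cost at most `T`, and then array `1`
contains the output `y`. -/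
def HaltsWithin (P : Program) (x : List ℕ) {N : ℕ} (r : Fin N → Bool) (T : ℕ) (y : ℕ → ℕ) : Prop :=
  ∃ (τ : State) (t : ℕ), Exec P (initialState x (List.ofFn r)) τ t ∧ t ≤ T ∧ τ.mem 1 = y

/-- The expectation over `N` independent fair coin tosses. -/
noncomputable def coinExpectation {N : ℕ} (f : (Fin N → Bool) → ℝ) : ℝ :=
  (∑ r, f r) / 2 ^ N

/-- `P` is a randomized polynomial-time `c`-approximation algorithm for the revenue-maximizing
`K`-anonymous signaling scheme. For some polynomial `T` and every instance, whatever the coins show,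
`P` halts within time `T` of the input size and outputs a `K`-anonymous scheme, and the expected
revenue of this scheme times `c` is at least the revenue of every `K`-anonymous scheme. As each toss
costs at least one unit of time, a supply of as many coins as time units is no restriction. -/
def IsRandomizedPolyTimeRevenueApprox (c : ℝ) (P : Program) : Prop :=
  ∃ T : Polynomial ℕ, ∀ I : Instance,
    ∃ out : (Fin (T.eval (inputSize I.encode)) → Bool) → ℕ → ℕ,
      (∀ r, HaltsWithin P I.encode r (T.eval (inputSize I.encode)) (out r)) ∧
      (∀ r, IsKAnonymous I.K (fun j : Fin I.m => out r j)) ∧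
      ∀ s : Scheme I.m, IsKAnonymous I.K s →
        (I.revenue s : ℝ) ≤ c * coinExpectation fun r => (I.revenue fun j => out r j : ℝ)

end KAnonSignaling

namespace KAnonSignaling

/-! The witness is a deterministic program of ratio 5e/(e-1), so the expectation is over a constant.
Scale all `p j * v i j` by the product of the denominators to integers `w i j`, and let `top` be the
bidder with the largest total.

Upper bound. After any signal, the second highest bid is at most the bid of some bidder other than
`top`, or is zero. A K-anonymous scheme uses at most R = m / max(K, 1) signals, so its scaled
revenue is at most the value of an assignment of categories to at most R bidders, with the values of
`top` set to zero (`Scaled.exists_revenue_le`). The best such assignment maximizes a monotone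
submodular function of the set of bidders, so R greedy rounds achieve a fraction 1 - 1/e of it
(`GreedyInv.succ`, `GreedyInv.exp_approx`). Call the greedy value G.

Lower bound. Sort the bidders by their shares σ₀ ≥ σ₁ ≥ ... of G; at most R shares are nonzero. With
Q = R / 2, monotonicity gives G ≤ σ₀ + 2(σ₁ + σ₃ + ... + σ_{2Q-1}) (`sum_cur_le`). The term σ₀ is at
most the second largest total, which a single signal earns (`Scaled.le_revenue_const`). For the
rest, the bidders of ranks 2g and 2g+1 share one signal. Each contributes only the better half of
its categories, which retains half of its share, so signal g earns at least σ_{2g+1} / 2. The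
discarded halves suffice to fill every signal up to K categories (`lack_le_count`). Hence G ≤ sec +
4 Rev, where sec is the second largest total and Rev the scaled revenue of the groups
(`Scaled.le_revenue_group`). If sec ≥ G/5 the single signal earns G/5, and otherwise the groups do.

Running time. The program consists of tabulations of sums and of counted repetitions of these, with
loop bounds read from the input. The number of elementary steps is therefore polynomial
(`Computes`). Every product has a factor no longer than a constant multiple of an input entry, so
the digits grow only additively and the logarithmic cost is polynomial too (`Run.exec`). -/

theorem Memory.write_apply (mem : Memory) (a k x b l : ℕ) :
    mem.write a k x b l = if b = a ∧ l = k then x else mem b l := by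
  simp only [write, Function.update_apply]
  split_ifs <;> simp_all

/-! ### Coin-free programs and their running time -/

/-- `Run P mem mem' N`: the coin-free program `P` turns `mem` into `mem'` in `N` elementary steps. -/
inductive Run : Program → Memory → Memory → ℕ → Prop
  | skip (mem : Memory) : Run .skip mem mem 1
  | write (mem : Memory) (a : ℕ) (idx e : Expr) :
      Run (.write a idx e) mem (mem.write a (idx.val mem) (e.val mem)) 1
  | seq {P Q : Program} {mem mem' mem'' : Memory} {N N' : ℕ} :
      Run P mem mem' N → Run Q mem' mem'' N' → Run (.seq P Q) mem mem'' (N + N')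
  | while_true {c : Expr} {P : Program} {mem mem' mem'' : Memory} {N N' : ℕ} :
      c.val mem ≠ 0 → Run P mem mem' N → Run (.while c P) mem' mem'' N' →
        Run (.while c P) mem mem'' (1 + N + N')
  | while_false {c : Expr} {P : Program} {mem : Memory} :
      c.val mem = 0 → Run (.while c P) mem mem 1

namespace Expr

/-- A constant counts with its value, so that the length also bounds its number of digits. -/
def len : Expr → ℕ
  | const c => c + 1
  | read _ idx => idx.len + 1
  | op _ e₁ e₂ => e₁.len + e₂.len + 1

/-- Expressions whose value is no longer than the entries of the input. -/
def Small : Expr → Prop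
  | const _ => True
  | read a _ => a = 0
  | op .lt _ _ => True
  | op .eq _ _ => True
  | op _ _ _ => False

/-- Expressions in which the second factor of every product is small. -/
def Safe : Expr → Prop
  | const _ => True
  | read _ idx => idx.Safe
  | op .mul e₁ e₂ => e₁.Safe ∧ e₂.Safe ∧ e₂.Small
  | op _ e₁ e₂ => e₁.Safe ∧ e₂.Safe

/-- All arrays that the expression mentions satisfy `p`. -/
def Only (p : ℕ → Prop) : Expr → Prop
  | const _ => True
  | read a idx => p a ∧ idx.Only p
  | op _ e₁ e₂ => e₁.Only p ∧ e₂.Only p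

instance : Add Expr := ⟨op .add⟩
instance : Sub Expr := ⟨op .sub⟩
instance : Mul Expr := ⟨op .mul⟩
instance : Div Expr := ⟨op .div⟩

theorem val_congr {p : ℕ → Prop} {mem mem' : Memory} (h : ∀ a, p a → mem a = mem' a) :
    ∀ {e : Expr}, e.Only p → e.val mem = e.val mem'
  | const _, _ => rfl
  | read a idx, he => by
      simp only [val, val_congr h he.2, h a he.1]
  | op o e₁ e₂, he => by
      simp only [val, val_congr h he.1, val_congr h he.2]

theorem val_size_of_small {L : ℕ} {mem : Memory} (hL : ∀ k, (mem 0 k).size ≤ L) :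
    ∀ {e : Expr}, e.Small → (e.val mem).size ≤ e.len * (L + 1)
  | const c, _ => by
      have : c.size ≤ c := Nat.size_le.2 Nat.lt_two_pow_self
      simp only [val, len]; nlinarith
  | read a idx, he => by
      obtain rfl : a = 0 := he
      have := hL (idx.val mem)
      simp only [val, len]; nlinarith
  | op .lt e₁ e₂, _ => by
      have : (if e₁.val mem < e₂.val mem then 1 else 0 : ℕ).size ≤ 1 := by split_ifs <;> simp
      simp only [val, len, Op.apply]; nlinarith
  | op .eq e₁ e₂, _ => by
      have : (if e₁.val mem = e₂.val mem then 1 else 0 : ℕ).size ≤ 1 := by split_ifs <;> simp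
      simp only [val, len, Op.apply]; nlinarith

end Expr

theorem size_add_le {x y k : ℕ} (hx : x.size ≤ k) (hy : y.size ≤ k) : (x + y).size ≤ k + 1 := by
  rw [Nat.size_le] at *
  rw [pow_succ]; omega

theorem size_mul_le {x y k l : ℕ} (hx : x.size ≤ k) (hy : y.size ≤ l) :
    (x * y).size ≤ k + l := by
  rw [Nat.size_le] at *
  rw [pow_add]; exact Nat.mul_lt_mul'' hx hy

namespace Expr

/-- Only multiplication could double the number of digits. In a safe product the second factor has a
length that does not depend on `B`, so `B` enters the bound once and without a coefficient. -/
theorem val_size {L B : ℕ} {mem : Memory} (hL : ∀ k, (mem 0 k).size ≤ L)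
    (hB : ∀ a k, (mem a k).size ≤ B) :
    ∀ {e : Expr}, e.Safe → (e.val mem).size ≤ B + e.len * (L + 1)
  | const c, _ => (val_size_of_small hL (e := const c) trivial).trans (Nat.le_add_left _ _)
  | read a idx, _ => (hB a _).trans (Nat.le_add_right _ _)
  | op .mul e₁ e₂, he => by
      have h₁ := val_size hL hB he.1
      have h₂ := val_size_of_small hL he.2.2
      refine (size_mul_le h₁ h₂).trans ?_
      simp only [len]; nlinarith
  | op .add e₁ e₂, he => by
      have h₁ := val_size hL hB he.1
      have h₂ := val_size hL hB he.2
      refine (size_add_le (k := B + (e₁.len + e₂.len) * (L + 1)) (h₁.trans ?_)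
        (h₂.trans ?_)).trans ?_ <;> (try simp only [len]) <;> nlinarith
  | op .sub e₁ e₂, he => by
      have h₁ := val_size hL hB he.1
      refine (Nat.size_le_size (Nat.sub_le _ _)).trans (h₁.trans ?_)
      simp only [len]; nlinarith
  | op .div e₁ e₂, he => by
      have h₁ := val_size hL hB he.1
      refine (Nat.size_le_size (Nat.div_le_self _ _)).trans (h₁.trans ?_)
      simp only [len]; nlinarith
  | op .lt e₁ e₂, _ =>
      (val_size_of_small hL (e := op .lt e₁ e₂) trivial).trans (Nat.le_add_left _ _)
  | op .eq e₁ e₂, _ =>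
      (val_size_of_small hL (e := op .eq e₁ e₂) trivial).trans (Nat.le_add_left _ _)

theorem safe_args {o : Op} {e₁ e₂ : Expr} (h : (op o e₁ e₂).Safe) : e₁.Safe ∧ e₂.Safe := by
  cases o
  case mul => exact ⟨h.1, h.2.1⟩
  all_goals exact h

/-- Each node is charged for at most three numbers, and `X` bounds the digits of every intermediate
value. -/
theorem cost_le {L B : ℕ} {mem : Memory} (hL : ∀ k, (mem 0 k).size ≤ L)
    (hB : ∀ a k, (mem a k).size ≤ B) {X : ℕ} :
    ∀ {e : Expr}, e.Safe → B + e.len * (L + 1) ≤ X → e.cost mem ≤ e.len * (3 * X + 1)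
  | const c, _, hX => by
      have := (val_size hL hB (e := const c) trivial).trans hX
      simp only [cost, val, len] at *; nlinarith
  | read a idx, he, hX => by
      have h₁ := val_size hL hB (e := idx) he
      have h₂ := hB a (idx.val mem)
      have h₃ := cost_le hL hB (X := X) (e := idx) he (by simp only [len] at hX; nlinarith)
      simp only [cost, len] at *; nlinarith
  | op o e₁ e₂, he, hX => by
      have h₀ := val_size hL hB he
      have h₁ := val_size hL hB (safe_args he).1
      have h₂ := val_size hL hB (safe_args he).2
      have h₃ := cost_le hL hB (X := X) (safe_args he).1 (by simp only [len] at hX; nlinarith)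
      have h₄ := cost_le hL hB (X := X) (safe_args he).2 (by simp only [len] at hX; nlinarith)
      simp only [cost, len, val] at *; nlinarith

end Expr

/-- Coin-free programs that never write to the input and whose expressions are safe and have length
at most `c`. -/
def Program.Safe (c : ℕ) : Program → Prop
  | .skip => True
  | .write a idx e => a ≠ 0 ∧ (idx.Safe ∧ idx.len ≤ c) ∧ e.Safe ∧ e.len ≤ c
  | .seq P Q => P.Safe c ∧ Q.Safe c
  | .while e P => (e.Safe ∧ e.len ≤ c) ∧ P.Safe c
  | _ => False

/-- In `N` steps of a safe program the entries grow by at most `N * c * (L + 1)` digits, so that the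
logarithmic cost is polynomial in the number of steps. -/
theorem Run.exec {P : Program} {mem mem' : Memory} {N c L : ℕ} (h : Run P mem mem' N)
    (hP : P.Safe c) (hL : ∀ k, (mem 0 k).size ≤ L) (coins : List Bool) :
    mem' 0 = mem 0 ∧ ∀ B, (∀ a k, (mem a k).size ≤ B) →
      (∀ a k, (mem' a k).size ≤ B + N * (c * (L + 1))) ∧
      ∃ t, Exec P ⟨mem, coins⟩ ⟨mem', coins⟩ t ∧
        t ≤ N * (1 + 2 * c * (3 * (B + N * (c * (L + 1))) + 1)) := by
  induction h with
  | skip mem =>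
    exact ⟨rfl, fun B hB => ⟨fun a k => (hB a k).trans (Nat.le_add_right _ _), _, Exec.skip _,
      by rw [one_mul]; exact Nat.le_add_right _ _⟩⟩
  | write mem a idx e =>
    obtain ⟨ha, ⟨hi, hil⟩, he, hel⟩ := hP
    refine ⟨?_, fun B hB => ⟨fun b k => ?_, _, Exec.write _ _ _ _, ?_⟩⟩
    · simp [Memory.write, Function.update_of_ne ha.symm]
    · have h₁ := Expr.val_size hL hB he
      have h₂ : e.len * (L + 1) ≤ c * (L + 1) := Nat.mul_le_mul_right _ hel
      have h₃ := hB b k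
      have h₄ := hB a k
      simp only [Memory.write_apply]
      split_ifs <;> omega
    · have h₁ := Expr.cost_le hL hB (X := B + c * (L + 1)) hi
        (by have : idx.len * (L + 1) ≤ c * (L + 1) := Nat.mul_le_mul_right _ hil
            omega)
      have h₂ := Expr.cost_le hL hB (X := B + c * (L + 1)) he
        (by have : e.len * (L + 1) ≤ c * (L + 1) := Nat.mul_le_mul_right _ hel
            omega)
      have h₃ := Nat.mul_le_mul_right (3 * (B + c * (L + 1)) + 1) hil
      have h₄ := Nat.mul_le_mul_right (3 * (B + c * (L + 1)) + 1) hel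
      simp only [one_mul]
      rw [mul_assoc 2]
      omega
  | @seq P Q mem mem' mem'' N N' _ _ ih₁ ih₂ =>
    obtain ⟨h₁, g₁⟩ := ih₁ hP.1 hL
    obtain ⟨h₂, g₂⟩ := ih₂ hP.2 (by rwa [h₁])
    refine ⟨h₂.trans h₁, fun B hB => ?_⟩
    obtain ⟨b₁, t, e₁, c₁⟩ := g₁ B hB
    -- The second program starts from the digit bound that the first one leaves. The bound `L` is
    -- unchanged because the input array is never written.
    obtain ⟨b₂, u, e₂, c₂⟩ := g₂ _ b₁
    refine ⟨fun a k => (b₂ a k).trans (by rw [add_assoc, ← add_mul]), _, Exec.seq e₁ e₂, ?_⟩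
    have m₁ : B + N * (c * (L + 1)) ≤ B + (N + N') * (c * (L + 1)) := by
      rw [add_mul]; omega
    have m₂ : B + N * (c * (L + 1)) + N' * (c * (L + 1)) = B + (N + N') * (c * (L + 1)) := by
      rw [add_mul]; omega
    rw [m₂] at c₂
    generalize B + (N + N') * (c * (L + 1)) = Y at *
    generalize B + N * (c * (L + 1)) = Y' at *
    rw [add_mul]
    refine add_le_add (c₁.trans ?_) c₂
    gcongr
  | @while_true e P mem mem' mem'' N N' hne _ _ ih₁ ih₂ =>
    obtain ⟨h₁, g₁⟩ := ih₁ hP.2 hL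
    obtain ⟨h₂, g₂⟩ := ih₂ hP (by rwa [h₁])
    refine ⟨h₂.trans h₁, fun B hB => ?_⟩
    obtain ⟨b₁, t, e₁, c₁⟩ := g₁ B hB
    obtain ⟨b₂, u, e₂, c₂⟩ := g₂ _ b₁
    have h₃ := Expr.cost_le hL hB (X := B + c * (L + 1)) hP.1.1
        (by have : e.len * (L + 1) ≤ c * (L + 1) := Nat.mul_le_mul_right _ hP.1.2
            omega)
    have h₄ := Nat.mul_le_mul_right (3 * (B + c * (L + 1)) + 1) hP.1.2
    have m₀ : B + c * (L + 1) ≤ B + (1 + N + N') * (c * (L + 1)) := by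
      rw [add_mul, add_mul]; omega
    have m₁ : B + N * (c * (L + 1)) ≤ B + (1 + N + N') * (c * (L + 1)) := by
      rw [add_mul, add_mul]; omega
    have m₂ : B + N * (c * (L + 1)) + N' * (c * (L + 1)) ≤
        B + (1 + N + N') * (c * (L + 1)) := by
      rw [add_mul, add_mul]; omega
    refine ⟨fun a k => (b₂ a k).trans m₂, _, Exec.while_true hne e₁ e₂, ?_⟩
    have c₃ := h₃.trans h₄
    generalize B + (1 + N + N') * (c * (L + 1)) = Y at *
    generalize B + N * (c * (L + 1)) + N' * (c * (L + 1)) = Y₂ at *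
    generalize B + N * (c * (L + 1)) = Y₁ at *
    generalize B + c * (L + 1) = Y₀ at *
    have d₁ : t ≤ N * (1 + 2 * c * (3 * Y + 1)) := c₁.trans (by gcongr)
    have d₂ : u ≤ N' * (1 + 2 * c * (3 * Y + 1)) := c₂.trans (by gcongr)
    have d₃ : e.cost mem ≤ c * (3 * Y + 1) := c₃.trans (by gcongr)
    rw [add_mul, add_mul, one_mul]
    rw [mul_assoc 2] at *
    dsimp only
    omega
  | @while_false e P mem hne =>
    refine ⟨rfl, fun B hB => ⟨fun a k => (hB a k).trans (Nat.le_add_right _ _), _,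
      Exec.while_false hne, ?_⟩⟩
    have h₃ := Expr.cost_le hL hB (X := B + c * (L + 1)) hP.1.1
        (by have : e.len * (L + 1) ≤ c * (L + 1) := Nat.mul_le_mul_right _ hP.1.2
            omega)
    have h₄ := Nat.mul_le_mul_right (3 * (B + c * (L + 1)) + 1) hP.1.2
    rw [one_mul, one_mul, mul_assoc 2]
    dsimp only
    omega

/-! ### Tabulations and repetitions -/

namespace Memory

variable (mem : Memory)

theorem write_same (a k x : ℕ) : mem.write a k x a k = x := by simp [write]

theorem write_of_ne {a b : ℕ} (h : b ≠ a) (k x : ℕ) : mem.write a k x b = mem b := by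
  simp [write, Function.update_of_ne h]

end Memory

/-- The scalar stored in array `a`. -/
def cell (a : ℕ) : Expr := .read a (.const 0)

/-- Arrays `2` and `3` hold the two running indices of a tabulation. -/
def setIndices (mem : Memory) (x y : ℕ) : Memory := (mem.write 2 0 x).write 3 0 y

/-- The effect of a tabulation. -/
def tabulate (a : ℕ) (n k e : Expr) (mem : Memory) : Memory := fun b x =>
  if b = a ∧ x < n.val mem then ∑ y ∈ Finset.range (k.val mem), e.val (setIndices mem x y)
  else mem b x

/-- Array `4` accumulates the sum; it and the column index are reset by `tab` after each row. -/
def tabInner (k e : Expr) : Program :=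
  .while (.op .lt (cell 3) k)
    (.seq (.write 4 (.const 0) (cell 4 + e)) (.write 3 (.const 0) (cell 3 + .const 1)))

/-- Fill the first `n` cells of array `a` with the sums of the values of `e`, whose second index
runs through the numbers below `k`. -/
def tab (a : ℕ) (n k e : Expr) : Program :=
  .seq
    (.while (.op .lt (cell 2) n)
      (.seq (tabInner k e)
        (.seq (.write a (cell 2) (cell 4))
          (.seq (.write 4 (.const 0) (.const 0))
            (.seq (.write 3 (.const 0) (.const 0)) (.write 2 (.const 0) (cell 2 + .const 1)))))))
    (.write 2 (.const 0) (.const 0))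

/-- The indices and the accumulator of the tabulations are cleared. -/
def Clear (mem : Memory) : Prop := mem 2 0 = 0 ∧ mem 3 0 = 0 ∧ mem 4 0 = 0

@[simp] theorem cell_val (mem : Memory) (a : ℕ) : (cell a).val mem = mem a 0 := rfl

@[simp] theorem add_val (mem : Memory) (e₁ e₂ : Expr) :
    (e₁ + e₂).val mem = e₁.val mem + e₂.val mem := rfl

@[simp] theorem sub_val (mem : Memory) (e₁ e₂ : Expr) :
    (e₁ - e₂).val mem = e₁.val mem - e₂.val mem := rfl

@[simp] theorem mul_val (mem : Memory) (e₁ e₂ : Expr) :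
    (e₁ * e₂).val mem = e₁.val mem * e₂.val mem := rfl

@[simp] theorem div_val (mem : Memory) (e₁ e₂ : Expr) :
    (e₁ / e₂).val mem = e₁.val mem / e₂.val mem := rfl

/-- A loop that is governed by a counter in array `b`. -/
theorem Run.countLoop {b : ℕ} {n : Expr} {P : Program} {M : ℕ → Memory} {ν N : ℕ}
    (hν : ∀ i ≤ ν, n.val (M i) = ν) (hb : ∀ i ≤ ν, M i b 0 = i)
    (h : ∀ i < ν, ∃ N' ≤ N, Run P (M i) (M (i + 1)) N') :
    ∃ N' ≤ ν * (N + 1) + 1, Run (.while (.op .lt (cell b) n) P) (M 0) (M ν) N' := by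
  suffices H : ∀ d i, i + d = ν → ∃ N' ≤ d * (N + 1) + 1,
      Run (.while (.op .lt (cell b) n) P) (M i) (M ν) N' from H ν 0 (Nat.zero_add _)
  intro d
  induction d with
  | zero =>
    rintro i rfl
    refine ⟨1, by omega, Run.while_false ?_⟩
    simp [Expr.val, Op.apply, hb i le_rfl, hν i le_rfl]
  | succ d ih =>
    intro i hi
    obtain ⟨N₁, h₁, r₁⟩ := h i (by omega)
    obtain ⟨N₂, h₂, r₂⟩ := ih (i + 1) (by omega)
    refine ⟨1 + N₁ + N₂, by rw [add_mul]; omega, Run.while_true ?_ r₁ r₂⟩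
    simp [Expr.val, Op.apply, hb i (by omega), hν i (by omega)]
    omega

theorem Memory.ext {mem mem' : Memory} (h : ∀ a k, mem a k = mem' a k) : mem = mem' :=
  funext fun a => funext fun k => h a k

/-- Here `mem₀` is the memory at the start of the whole tabulation and `mem` the memory at the start
of row `x`. They may differ in array `a`, which `e` does not read, so the entries may be evaluated
in `mem₀`. -/
theorem run_tabInner {a : ℕ} {k e : Expr} (hk : k.Only (· = 0))
    (he : e.Only fun b => b ≠ a ∧ b ≠ 4) (mem mem₀ : Memory) (x : ℕ)
    (h₃ : mem 3 0 = 0) (h₄ : mem 4 0 = 0)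
    (hmem : ∀ b, b ≠ a → b ≠ 2 → mem b = mem₀ b)
    (hx : mem 2 = (mem₀.write 2 0 x) 2) (ha : a ≠ 0 ∧ a ≠ 2 ∧ a ≠ 3 ∧ a ≠ 4) :
    ∃ N ≤ k.val mem₀ * 3 + 1, Run (tabInner k e) mem
      ((mem.write 4 0 (∑ y ∈ Finset.range (k.val mem₀), e.val (setIndices mem₀ x y))).write 3 0
        (k.val mem₀)) N := by
  let M : ℕ → Memory := fun y =>
    (mem.write 4 0 (∑ y ∈ Finset.range y, e.val (setIndices mem₀ x y))).write 3 0 y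
  have hM0 : M 0 = mem := by
    refine Memory.ext fun b l => ?_
    simp only [M, Memory.write_apply, Finset.sum_range_zero]
    grind
  have := Run.countLoop (b := 3) (n := k) (M := M) (ν := k.val mem₀) (N := 2)
    (P := .seq (.write 4 (.const 0) (cell 4 + e)) (.write 3 (.const 0) (cell 3 + .const 1)))
    (fun i _ => Expr.val_congr (p := (· = 0)) (by
      rintro _ rfl
      simp only [M]
      rw [Memory.write_of_ne _ (by decide), Memory.write_of_ne _ (by decide)]
      exact hmem 0 (by omega) (by decide)) hk)
    (fun i _ => Memory.write_same _ _ _ _)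
    (fun y hy => ⟨2, le_rfl, by
      have h := Run.seq (Run.write (M y) 4 (.const 0) (cell 4 + e))
        (Run.write _ 3 (.const 0) (cell 3 + .const 1))
      convert h using 1
      have hev : e.val (M y) = e.val (setIndices mem₀ x y) := by
        refine Expr.val_congr (p := fun b => b ≠ a ∧ b ≠ 4) (fun b hb => ?_) he
        funext l
        have q := congrFun hx l
        by_cases hb3 : b = 3
        · subst hb3
          have := hmem 3 hb.1 (by decide)
          simp [M, setIndices, Memory.write, this, Function.update_apply]
        by_cases hb2 : b = 2
        · subst hb2
          simpa [M, setIndices, Memory.write, Function.update_apply] using q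
        simp [M, setIndices, Memory.write, hb2, hb3, hb.2, hmem b hb.1 hb2]
      refine Memory.ext fun b l => ?_
      simp only [add_val, cell_val, hev]
      simp only [M, Memory.write_apply, Finset.sum_range_succ, Expr.val]
      grind⟩)
  rw [hM0] at this
  exact this

theorem run_tab {a : ℕ} {n k e : Expr} (ha : a ≠ 0 ∧ a ≠ 2 ∧ a ≠ 3 ∧ a ≠ 4)
    (hn : n.Only (· = 0)) (hk : k.Only (· = 0))
    (he : e.Only fun b => b ≠ a ∧ b ≠ 4) (mem : Memory) (hmem : Clear mem) :
    ∃ N ≤ n.val mem * (k.val mem * 3 + 6) + 2,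
      Run (tab a n k e) mem (tabulate a n k e mem) N := by
  obtain ⟨c₂, c₃, c₄⟩ := hmem
  let S : ℕ → ℕ := fun x => ∑ y ∈ Finset.range (k.val mem), e.val (setIndices mem x y)
  -- The loop invariant as an explicit memory: the first `x` cells are filled, the row index is `x`,
  -- and all else is as at the start.
  let M : ℕ → Memory := fun x => Memory.write
    (fun b x' => if b = a ∧ x' < x then S x' else mem b x') 2 0 x
  have hM0 : M 0 = mem := by
    refine Memory.ext fun b l => ?_
    simp only [M, Memory.write_apply]
    grind
  have hM : ∀ x b, b ≠ a → b ≠ 2 → M x b = mem b := by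
    intro x b h₁ h₂
    simp only [M]
    rw [Memory.write_of_ne _ h₂]
    simp [h₁]
  have hM2 : ∀ x, M x 2 = (mem.write 2 0 x) 2 := by
    intro x
    funext l
    simp [M, Memory.write_apply, show 2 ≠ a by omega]
  obtain ⟨N, hN, hr⟩ := Run.countLoop (b := 2) (n := n) (M := M) (ν := n.val mem)
    (N := k.val mem * 3 + 5)
    (P := .seq (tabInner k e)
        (.seq (.write a (cell 2) (cell 4))
          (.seq (.write 4 (.const 0) (.const 0))
            (.seq (.write 3 (.const 0) (.const 0)) (.write 2 (.const 0) (cell 2 + .const 1))))))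
    (fun i _ => Expr.val_congr (p := (· = 0)) (by
      rintro _ rfl
      exact hM i 0 (by omega) (by decide)) hn)
    (fun i _ => Memory.write_same _ _ _ _)
    (fun x hx => by
      obtain ⟨N, hN, hr⟩ := run_tabInner hk he (M x) mem x
        (by rw [hM x 3 (by omega) (by decide), c₃]) (by rw [hM x 4 (by omega) (by decide), c₄])
        (hM x) (hM2 x) ha
      refine ⟨N + (1 + (1 + (1 + 1))), by omega, ?_⟩
      have h := Run.seq hr (Run.seq (Run.write _ a (cell 2) (cell 4))
        (Run.seq (Run.write _ 4 (.const 0) (.const 0))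
          (Run.seq (Run.write _ 3 (.const 0) (.const 0))
            (Run.write _ 2 (.const 0) (cell 2 + .const 1)))))
      convert h using 1
      refine Memory.ext fun b l => ?_
      have n₁ : a ≠ 2 := by omega
      have n₂ : a ≠ 3 := by omega
      have n₃ : a ≠ 4 := by omega
      simp only [add_val, cell_val]
      simp only [M, Memory.write_apply, Expr.val]
      grind)
  rw [hM0] at hr
  refine ⟨N + 1, by rw [show k.val mem * 3 + 6 = k.val mem * 3 + 5 + 1 from rfl]; omega, ?_⟩
  have h := Run.seq hr (Run.write _ 2 (.const 0) (.const 0))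
  suffices E : tabulate a n k e mem = _ by rw [E]; exact h
  refine Memory.ext fun b l => ?_
  simp only [tabulate, M, Memory.write_apply, Expr.val, S]
  grind

theorem tabulate_of_ne {a b : ℕ} (h : b ≠ a) (n k e : Expr) (mem : Memory) :
    tabulate a n k e mem b = mem b := by
  funext x
  simp [tabulate, h]

/-! ### Transformations computed in polynomially many steps -/

/-- A quantity that bounds the numbers of iterations of all loops. -/
def scale (mem : Memory) : ℕ := mem 0 0 + mem 0 1 + mem 0 1 * mem 0 0 + 1

/-- `P` computes the transformation `F` of the memory, in a number of steps that is polynomial in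
`scale`. -/
def Computes (P : Program) (F : Memory → Memory) : Prop :=
  ∃ q : Polynomial ℕ, ∀ mem, Clear mem →
    (∃ N ≤ q.eval (scale mem), Run P mem (F mem) N) ∧ Clear (F mem) ∧ F mem 0 = mem 0

/-- The first program preserves the input, hence `scale`, and leaves the indices cleared, so the
bound for the second applies unchanged. -/
theorem Computes.seq {P Q : Program} {F G : Memory → Memory} (hP : Computes P F)
    (hQ : Computes Q G) : Computes (.seq P Q) fun mem => G (F mem) := by
  obtain ⟨p, hp⟩ := hP
  obtain ⟨q, hq⟩ := hQ
  refine ⟨p + q, fun mem hm => ?_⟩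
  obtain ⟨⟨N, hN, hr⟩, hc, h₀⟩ := hp mem hm
  obtain ⟨⟨N', hN', hr'⟩, hc', h₀'⟩ := hq _ hc
  have hs : scale (F mem) = scale mem := by simp [scale, h₀]
  rw [hs] at hN'
  exact ⟨⟨N + N', by rw [Polynomial.eval_add]; omega, Run.seq hr hr'⟩, hc', h₀'.trans h₀⟩

theorem Computes.tab {a : ℕ} {n k e : Expr} (ha : a ≠ 0 ∧ a ≠ 2 ∧ a ≠ 3 ∧ a ≠ 4)
    (hn : n.Only (· = 0)) (hk : k.Only (· = 0)) (he : e.Only fun b => b ≠ a ∧ b ≠ 4)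
    (hns : ∀ mem, n.val mem ≤ scale mem) (hks : ∀ mem, k.val mem ≤ scale mem) :
    Computes (tab a n k e) (tabulate a n k e) := by
  refine ⟨.X * (.X * 3 + 6) + 2, fun mem hm => ?_⟩
  obtain ⟨N, hN, hr⟩ := run_tab ha hn hk he mem hm
  refine ⟨⟨N, hN.trans ?_, hr⟩, ?_, tabulate_of_ne (by omega) _ _ _ _⟩
  · have h₁ := hns mem
    have h₂ := hks mem
    simp only [Polynomial.eval_add, Polynomial.eval_mul, Polynomial.eval_X,
      Polynomial.eval_ofNat]
    gcongr
  · simpa only [Clear, tabulate_of_ne (show 2 ≠ a by omega), tabulate_of_ne (show 3 ≠ a by omega),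
      tabulate_of_ne (show 4 ≠ a by omega)] using hm

/-- The data of a tabulation. -/
structure Table where
  array : ℕ
  rows : Expr
  cols : Expr
  entry : Expr

namespace Table

/-- The bounds depend on the input only and are small, and the entries do not depend on the array
that is written. -/
structure Valid (t : Table) : Prop where
  array_ne : t.array ≠ 0 ∧ t.array ≠ 2 ∧ t.array ≠ 3 ∧ t.array ≠ 4
  rows_only : t.rows.Only (· = 0)
  cols_only : t.cols.Only (· = 0)
  entry_only : t.entry.Only fun b => b ≠ t.array ∧ b ≠ 4
  rows_le : ∀ mem, t.rows.val mem ≤ scale mem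
  cols_le : ∀ mem, t.cols.val mem ≤ scale mem

def program (t : Table) : Program := tab t.array t.rows t.cols t.entry

def effect (mem : Memory) (t : Table) : Memory := tabulate t.array t.rows t.cols t.entry mem

theorem effect_of_ne {t : Table} {b : ℕ} (h : b ≠ t.array) (mem : Memory) :
    t.effect mem b = mem b := tabulate_of_ne h _ _ _ _

theorem effect_array {t : Table} {mem : Memory} {x : ℕ} (hx : x < t.rows.val mem) :
    t.effect mem t.array x = ∑ y ∈ Finset.range (t.cols.val mem), t.entry.val (setIndices mem x y) := by
  simp [effect, tabulate, hx]

end Table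

/-- Perform the tabulations of a list. -/
def block : List Table → Program
  | [] => .skip
  | t :: l => .seq t.program (block l)

theorem computes_block {l : List Table} (h : ∀ t ∈ l, t.Valid) :
    Computes (block l) fun mem => l.foldl Table.effect mem := by
  induction l with
  | nil => exact ⟨1, fun mem hm => ⟨⟨1, by simp, .skip _⟩, hm, rfl⟩⟩
  | cons t l ih =>
    have ht := h t (by simp)
    exact (Computes.tab ht.1 ht.2 ht.3 ht.4 ht.5 ht.6).seq (ih fun t' h' => h t' (by simp [h']))

/-- Repeat `P` as often as `n` says; array `5` counts. -/
def rep (n : Expr) (P : Program) : Program :=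
  .seq (.write 5 (.const 0) (.const 0))
    (.while (.op .lt (cell 5) n) (.seq P (.write 5 (.const 0) (cell 5 + .const 1))))

/-- The memory after `i` rounds of a repetition. -/
def rounds (F : Memory → Memory) (mem : Memory) : ℕ → Memory
  | 0 => mem.write 5 0 0
  | i + 1 => (F (rounds F mem i)).write 5 0 (i + 1)

theorem Computes.rep {n : Expr} {P : Program} {F : Memory → Memory} (hP : Computes P F)
    (hn : n.Only (· = 0)) (hns : ∀ mem, n.val mem ≤ scale mem) (hF : ∀ mem, F mem 5 = mem 5) :
    Computes (rep n P) fun mem => rounds F mem (n.val mem) := by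
  obtain ⟨p, hp⟩ := hP
  refine ⟨.X * (p + 2) + 2, fun mem hm => ?_⟩
  have H : ∀ i, Clear (rounds F mem i) ∧ rounds F mem i 0 = mem 0 ∧ rounds F mem i 5 0 = i := by
    intro i
    induction i with
    | zero =>
      simpa [rounds, Clear, Memory.write_of_ne, Memory.write_same] using hm
    | succ i ih =>
      obtain ⟨-, hc, h₀⟩ := hp _ ih.1
      refine ⟨?_, ?_, by simp [rounds, Memory.write_same]⟩
      · simpa [rounds, Clear, Memory.write_of_ne] using hc
      · simpa [rounds, Memory.write_of_ne, h₀] using ih.2.1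
  have hval : ∀ i, n.val (rounds F mem i) = n.val mem := fun i =>
    Expr.val_congr (p := (· = 0)) (by rintro _ rfl; exact (H i).2.1) hn
  obtain ⟨N, hN, hr⟩ := Run.countLoop (b := 5) (n := n) (M := rounds F mem) (ν := n.val mem)
    (N := p.eval (scale mem) + 1)
    (P := .seq P (.write 5 (.const 0) (cell 5 + .const 1)))
    (fun i _ => hval i) (fun i _ => (H i).2.2)
    (fun i _ => by
      obtain ⟨⟨N, hN, hr⟩, hc, h₀⟩ := hp _ (H i).1
      have hs : scale (rounds F mem i) = scale mem := by simp [scale, (H i).2.1]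
      rw [hs] at hN
      refine ⟨N + 1, by omega, ?_⟩
      have h := Run.seq hr (Run.write _ 5 (.const 0) (cell 5 + .const 1))
      simpa [Expr.val, Op.apply, rounds, hF, (H i).2.2] using h)
  refine ⟨⟨1 + N, ?_, Run.seq (Run.write mem 5 (.const 0) (.const 0)) hr⟩, (H _).1, (H _).2.1⟩
  have h₁ := hns mem
  simp only [Polynomial.eval_add, Polynomial.eval_mul, Polynomial.eval_X,
      Polynomial.eval_ofNat]
  have : n.val mem * (p.eval (scale mem) + 1 + 1) ≤ scale mem * (p.eval (scale mem) + 2) := by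
    gcongr
  omega

theorem eval_mono (q : Polynomial ℕ) {x y : ℕ} (h : x ≤ y) : q.eval x ≤ q.eval y := by
  simp only [Polynomial.eval_eq_sum, Polynomial.sum]
  gcongr

/-- A safe program that computes `F` runs in polynomial time, if the loop bounds do. -/
theorem Computes.haltsWithin {P : Program} {F : Memory → Memory} {c : ℕ} (h : Computes P F)
    (hP : P.Safe c) (s : Polynomial ℕ) :
    ∃ T : Polynomial ℕ, ∀ (x : List ℕ),
      scale (initialState x []).mem ≤ s.eval (inputSize x) →
      ∀ {N : ℕ} (r : Fin N → Bool),
        HaltsWithin P x r (T.eval (inputSize x)) (F (initialState x []).mem 1) := by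
  obtain ⟨q, hq⟩ := h
  let Q := q.comp s
  -- This is the cost bound of `Run.exec` with `Q` steps, where the input size serves both as the
  -- initial digit bound `B` and as the input digit bound `L`.
  refine ⟨Q * (1 + 2 * .C c * (3 * (.X + Q * (.C c * (.X + 1))) + 1)), fun x hx N r => ?_⟩
  have hc : Clear (initialState x []).mem := by simp [Clear, initialState]
  obtain ⟨⟨M, hM, hr⟩, -, -⟩ := hq _ hc
  have hsize : ∀ a k, ((initialState x []).mem a k).size ≤ inputSize x := by
    intro a k
    simp only [initialState]
    split_ifs
    · by_cases hk : k < x.length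
      · rw [List.getD_eq_getElem _ _ hk]
        have : (x[k].size + 1) ∈ x.map fun k => k.size + 1 :=
          List.mem_map.2 ⟨_, List.getElem_mem hk, rfl⟩
        exact (Nat.le_succ _).trans (List.single_le_sum (fun _ _ => Nat.zero_le _) _ this)
      · rw [List.getD_eq_default _ _ (not_lt.1 hk)]
        simp
    · simp
  obtain ⟨-, H⟩ := hr.exec hP (hsize 0) (List.ofFn r)
  obtain ⟨-, t, ht, hle⟩ := H _ hsize
  refine ⟨_, t, ht, hle.trans ?_, rfl⟩
  have hMQ : M ≤ Q.eval (inputSize x) := by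
    rw [Polynomial.eval_comp]
    exact hM.trans (eval_mono q hx)
  simp only [Polynomial.eval_add, Polynomial.eval_mul, Polynomial.eval_X, Polynomial.eval_C,
      Polynomial.eval_ofNat, Polynomial.eval_one]
  gcongr

open Finset

/-! ### Ranks -/

/-- `i'` comes before `i` in the order by decreasing keys, ties being broken by the index. -/
def Before (key : ℕ → ℕ) (i' i : ℕ) : Prop := key i < key i' ∨ key i = key i' ∧ i' < i

instance (key : ℕ → ℕ) (i' i : ℕ) : Decidable (Before key i' i) :=
  inferInstanceAs (Decidable (_ ∨ _))

/-- The number of elements of `A` that come before `i`. -/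
def rank (A : Finset ℕ) (key : ℕ → ℕ) (i : ℕ) : ℕ := #{i' ∈ A | Before key i' i}

section Rank

variable {A : Finset ℕ} {key : ℕ → ℕ} {i i' : ℕ}

theorem rank_lt_card (hi : i ∈ A) : rank A key i < #A :=
  card_lt_card ⟨filter_subset _ _, fun h => by
    have := (mem_filter.1 (h hi)).2
    simp [Before] at this⟩

theorem rank_lt_rank (hi' : i' ∈ A) (h : Before key i' i) : rank A key i' < rank A key i := by
  refine card_lt_card ⟨fun k hk => ?_, fun hs => ?_⟩
  · obtain ⟨hkA, hk⟩ := mem_filter.1 hk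
    refine mem_filter.2 ⟨hkA, ?_⟩
    simp only [Before] at *
    omega
  · have := (mem_filter.1 (hs (mem_filter.2 ⟨hi', h⟩))).2
    simp [Before] at this

theorem key_le_of_rank_le (hi : i ∈ A) (h : rank A key i' ≤ rank A key i) :
    key i ≤ key i' := by
  by_contra! hlt
  exact absurd (rank_lt_rank hi (Or.inl hlt)) (not_lt.2 h)

/-- Breaking ties by the index makes `Before` total on distinct elements, and ranks strictly
increase along it. -/
theorem rank_injOn : Set.InjOn (rank A key) A := by
  intro i hi i' hi' h
  by_contra hne
  have h₁ : ¬ Before key i i' := fun hb => absurd (rank_lt_rank hi hb) (by omega)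
  have h₂ : ¬ Before key i' i := fun hb => absurd (rank_lt_rank hi' hb) (by omega)
  simp only [Before] at h₁ h₂
  omega

/-- An injective map from `A` into the numbers below `#A` is onto. -/
theorem exists_rank_eq {k : ℕ} (hk : k < #A) : ∃ i ∈ A, rank A key i = k := by
  have := surjOn_of_injOn_of_card_le (s := A) (t := range #A) (rank A key)
    (fun i hi => by simpa using rank_lt_card hi) rank_injOn (by simp)
  obtain ⟨i, hi, h⟩ := this (by simpa using hk : k ∈ (range #A : Set ℕ))
  exact ⟨i, hi, h⟩

/-- The `k`-th largest key. -/
def sorted (A : Finset ℕ) (key : ℕ → ℕ) (k : ℕ) : ℕ := ∑ i ∈ A with rank A key i = k, key i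

theorem sorted_rank (hi : i ∈ A) : sorted A key (rank A key i) = key i := by
  have : ({i' ∈ A | rank A key i' = rank A key i} : Finset ℕ) = {i} := by
    ext i'
    simp only [mem_filter, mem_singleton]
    exact ⟨fun h => rank_injOn h.1 hi h.2, fun h => by subst h; exact ⟨hi, rfl⟩⟩
  rw [sorted, this, sum_singleton]

theorem sum_mul_rank_eq (f : ℕ → ℕ) (hi : i ∈ A) :
    ∑ i' ∈ A, f i' * (if rank A key i' = rank A key i then 1 else 0) = f i := by
  rw [sum_eq_single_of_mem i hi]
  · simp
  · intro i' hi' hne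
    rw [if_neg fun h => hne (rank_injOn hi' hi h), mul_zero]

theorem rank_congr {key' : ℕ → ℕ} (h : ∀ i ∈ A, key i = key' i) (hi : i ∈ A) :
    rank A key i = rank A key' i := by
  rw [rank, rank]
  congr 1
  refine filter_congr fun i' hi' => ?_
  rw [Before, Before, h i hi, h i' hi']

theorem sum_before (A : Finset ℕ) (key : ℕ → ℕ) (i : ℕ) :
    ∑ i' ∈ A, ((if key i < key i' then 1 else 0) +
      (if key i = key i' then 1 else 0) * (if i' < i then 1 else 0)) = rank A key i := by
  rw [rank, card_filter]
  refine sum_congr rfl fun i' _ => ?_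
  by_cases h : Before key i' i
  all_goals
    simp only [h, if_true, if_false]
    simp only [Before] at h
    split_ifs <;> omega

theorem sorted_eq_zero {k : ℕ} (hk : #A ≤ k) : sorted A key k = 0 := by
  rw [sorted, filter_false_of_mem, sum_empty]
  intro i hi
  have := rank_lt_card (key := key) hi
  omega

theorem sorted_antitone : Antitone (sorted A key) := by
  intro k k' h
  by_cases hk' : k' < #A
  · obtain ⟨i, hi, rfl⟩ := exists_rank_eq (key := key) (h.trans_lt hk')
    obtain ⟨i', hi', rfl⟩ := exists_rank_eq (key := key) hk'
    rw [sorted_rank hi, sorted_rank hi']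
    exact key_le_of_rank_le hi' h
  · rw [sorted_eq_zero (not_lt.1 hk')]
    exact Nat.zero_le _

theorem sum_sorted (p : ℕ → Prop) [DecidablePred p] {N : ℕ} (hN : #A ≤ N) :
    ∑ k ∈ range N with p k, sorted A key k = ∑ i ∈ A with p (rank A key i), key i := by
  rw [← sum_fiberwise_of_maps_to (s := {i ∈ A | p (rank A key i)}) (t := {k ∈ range N | p k})
    (g := rank A key)]
  · refine sum_congr rfl fun k hk => ?_
    rw [sorted, filter_filter]
    refine sum_congr (filter_congr fun i _ => ?_) fun _ _ => rfl
    have := (mem_filter.1 hk).2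
    constructor
    · rintro rfl; exact ⟨this, rfl⟩
    · exact fun h => h.2
  · intro i hi
    simp only [mem_filter, mem_range] at *
    exact ⟨(rank_lt_card hi.1).trans_le hN, hi.2⟩

theorem sum_sorted_range {N : ℕ} (hN : #A ≤ N) : ∑ k ∈ range N, sorted A key k = ∑ i ∈ A, key i := by
  simpa using sum_sorted (A := A) (key := key) (fun _ => True) hN

/-- The better half has at least half of the sum. -/
theorem sum_le_two_mul_sum_rank :
    ∑ i ∈ A, key i ≤ 2 * ∑ i ∈ A with 2 * rank A key i < #A, key i := by
  rw [← sum_sorted (fun k => 2 * k < #A) le_rfl, ← sum_sorted_range le_rfl,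
    ← sum_filter_add_sum_filter_not (range #A) (fun k => 2 * k < #A), two_mul]
  refine Nat.add_le_add_left ?_ _
  -- The reflection `k ↦ #A - 1 - k` sends the worse half injectively into the better half and does
  -- not decrease the keys.
  refine (sum_le_sum fun k hk => sorted_antitone (show #A - 1 - k ≤ k by
    simp only [mem_filter] at hk; omega)).trans ?_
  rw [← sum_image (s := {k ∈ range #A | ¬ 2 * k < #A}) (g := fun k => #A - 1 - k)
    (f := fun k => sorted A key k)]
  · refine sum_le_sum_of_subset fun k hk => ?_
    simp only [mem_image, mem_filter, mem_range] at *
    obtain ⟨l, hl, rfl⟩ := hk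
    omega
  · intro k hk l hl h
    simp only [coe_filter, mem_range, Set.mem_ofPred_eq] at *
    omega

/-- The ranks in the better half are distinct numbers below `(#A + 1) / 2`. The extra one occurs for
odd `#A`, when the middle element is counted. -/
theorem two_mul_card_rank_le : 2 * #{i ∈ A | 2 * rank A key i < #A} ≤ #A + 1 := by
  have h := card_le_card_of_injOn (s := {i ∈ A | 2 * rank A key i < #A})
    (t := range ((#A + 1) / 2)) (rank A key)
    (fun i hi => by
      simp only [coe_filter, Set.mem_ofPred_eq] at hi
      simp only [coe_range, Set.mem_Iio]
      omega)
    (rank_injOn.mono (by intro i hi; exact (mem_filter.1 hi).1))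
  rw [card_range] at h
  omega

end Rank

/-! ### The greedy choice of bidders -/

/-- The state of the greedy algorithm for the matrix `u` after `k` rounds: category `j` is assigned
to bidder `own j`, at value `cur j`. Any assignment that uses at most `R` bidders is approximated. -/
structure GreedyInv (m n R : ℕ) (u : ℕ → ℕ → ℕ) (k : ℕ) (cur own : ℕ → ℕ) : Prop where
  cur_zero : k = 0 → ∀ j < m, cur j = 0
  cur_eq : k ≠ 0 → ∀ j < m, own j < n ∧ cur j = u (own j) j
  card_le : k ≠ 0 → #((range m).image own) ≤ k
  approx : ∀ a : ℕ → ℕ, (∀ j < m, a j < n) → #((range m).image a) ≤ R →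
    (1 - (1 - 1 / (R : ℝ)) ^ k) * ∑ j ∈ range m, (u (a j) j : ℝ) ≤ ∑ j ∈ range m, (cur j : ℝ)

theorem GreedyInv.zero (m n R : ℕ) (u : ℕ → ℕ → ℕ) (cur own : ℕ → ℕ) (h : ∀ j < m, cur j = 0) :
    GreedyInv m n R u 0 cur own where
  cur_zero _ := h
  cur_eq h := absurd rfl h
  card_le h := absurd rfl h
  approx a _ _ := by
    simp only [pow_zero, sub_self, zero_mul]
    positivity

/-- The gain of adding bidder `i`. -/
def gain (m : ℕ) (u : ℕ → ℕ → ℕ) (cur : ℕ → ℕ) (i : ℕ) : ℕ := ∑ j ∈ range m, (u i j - cur j)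

/-- This is submodularity: category by category, the excess of `a` over `cur` is at most the sum of
the individual gains of the bidders that `a` uses. There are at most `R` of them, each with at most
the best gain. -/
theorem sum_le_of_gain_le {m n R : ℕ} {u : ℕ → ℕ → ℕ} {cur : ℕ → ℕ} {b : ℕ}
    (hmax : ∀ i < n, gain m u cur i ≤ gain m u cur b) (a : ℕ → ℕ) (ha : ∀ j < m, a j < n)
    (hR : #((range m).image a) ≤ R) :
    ∑ j ∈ range m, u (a j) j ≤ ∑ j ∈ range m, cur j + R * gain m u cur b := by
  calc ∑ j ∈ range m, u (a j) j
      ≤ ∑ j ∈ range m, (cur j + ∑ i ∈ (range m).image a, (u i j - cur j)) := by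
        refine sum_le_sum fun j hj => ?_
        have : u (a j) j - cur j ≤ ∑ i ∈ (range m).image a, (u i j - cur j) :=
          single_le_sum (f := fun i => u i j - cur j) (fun _ _ => Nat.zero_le _)
            (mem_image_of_mem a hj)
        omega
    _ = ∑ j ∈ range m, cur j + ∑ i ∈ (range m).image a, gain m u cur i := by
        rw [sum_add_distrib, sum_comm]
        rfl
    _ ≤ ∑ j ∈ range m, cur j + R * gain m u cur b := by
        refine Nat.add_le_add_left ?_ _
        refine (sum_le_card_nsmul _ _ (gain m u cur b) fun i hi => ?_).trans ?_
        · obtain ⟨j, hj, rfl⟩ := mem_image.1 hi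
          exact hmax _ (ha j (mem_range.1 hj))
        · rw [smul_eq_mul]
          exact Nat.mul_le_mul_right _ hR

/-- The best gain is at least a fraction `1 / R` of the gap to the assignment `a`, so each round
shrinks the guaranteed gap by the factor `1 - 1 / R`. -/
theorem GreedyInv.succ {m n R : ℕ} {u : ℕ → ℕ → ℕ} {k : ℕ} {cur own cur' own' : ℕ → ℕ} {b : ℕ}
    (h : GreedyInv m n R u k cur own) (hR : R ≠ 0) (hb : b < n)
    (hmax : ∀ i < n, gain m u cur i ≤ gain m u cur b)
    (hcur : ∀ j < m, cur' j = cur j + (u b j - cur j))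
    (hown : ∀ j < m, own' j = if u b j < cur j then own j else b) :
    GreedyInv m n R u (k + 1) cur' own' := by
  refine ⟨by simp, fun _ j hj => ?_, fun _ => ?_, fun a ha hRa => ?_⟩
  · rw [hcur j hj, hown j hj]
    split_ifs with hlt
    -- In the first round all current values are zero, so no category keeps its old owner and the
    -- initial content of `own` is irrelevant.
    · have hk : k ≠ 0 := by
        rintro rfl
        rw [h.cur_zero rfl j hj] at hlt
        omega
      refine ⟨(h.cur_eq hk j hj).1, ?_⟩
      rw [← (h.cur_eq hk j hj).2]
      omega
    · exact ⟨hb, by omega⟩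
  · by_cases hk : k = 0
    · have : (range m).image own' ⊆ {b} := by
        intro i hi
        obtain ⟨j, hj, rfl⟩ := mem_image.1 hi
        rw [hown j (mem_range.1 hj), h.cur_zero hk j (mem_range.1 hj)]
        simp
      have := card_le_card this
      rw [card_singleton] at this
      omega
    · have : (range m).image own' ⊆ insert b ((range m).image own) := by
        intro i hi
        obtain ⟨j, hj, rfl⟩ := mem_image.1 hi
        rw [hown j (mem_range.1 hj)]
        split_ifs
        · exact mem_insert_of_mem (mem_image_of_mem _ hj)
        · exact mem_insert_self _ _
      exact (card_le_card this).trans ((card_insert_le _ _).trans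
        (Nat.add_le_add_right (h.card_le hk) 1))
  · have h₁ := h.approx a ha hRa
    have h₂ : (∑ j ∈ range m, (u (a j) j : ℝ)) ≤ ∑ j ∈ range m, (cur j : ℝ) +
        R * (gain m u cur b : ℝ) := by
      exact_mod_cast sum_le_of_gain_le hmax a ha hRa
    have h₃ : ∑ j ∈ range m, (cur' j : ℝ) = ∑ j ∈ range m, (cur j : ℝ) +
        (gain m u cur b : ℝ) := by
      have : ∑ j ∈ range m, cur' j = ∑ j ∈ range m, cur j + gain m u cur b := by
        rw [gain, ← sum_add_distrib]
        exact sum_congr rfl fun j hj => hcur j (mem_range.1 hj)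
      exact_mod_cast this
    rw [h₃]
    generalize (∑ j ∈ range m, (u (a j) j : ℝ)) = O at *
    generalize ∑ j ∈ range m, (cur j : ℝ) = G at *
    generalize (gain m u cur b : ℝ) = D at *
    have hR' : (0 : ℝ) < R := by positivity
    have hR1 : (1 : ℝ) ≤ R := by exact_mod_cast Nat.one_le_iff_ne_zero.2 hR
    have hx : 0 ≤ 1 - 1 / (R : ℝ) := by
      rw [sub_nonneg, div_le_one hR']
      exact hR1
    have h₄ := mul_le_mul_of_nonneg_left h₁ hx
    have h₅ : O / R - G / R ≤ D := by
      rw [← sub_div, div_le_iff₀ hR']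
      linarith
    calc (1 - (1 - 1 / (R : ℝ)) ^ (k + 1)) * O
        = (1 - 1 / (R : ℝ)) * ((1 - (1 - 1 / (R : ℝ)) ^ k) * O) + O / R := by
          rw [pow_succ]; ring
      _ ≤ (1 - 1 / (R : ℝ)) * G + O / R := by linarith
      _ = G + (O / R - G / R) := by ring
      _ ≤ G + D := by linarith

/-- After `R` rounds the remaining gap has factor `(1 - 1 / R) ^ R`, which is at most `1 / e`
because `1 - x ≤ exp (-x)`. -/
theorem GreedyInv.exp_approx {m n R : ℕ} {u : ℕ → ℕ → ℕ} {cur own : ℕ → ℕ}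
    (h : GreedyInv m n R u R cur own) (hR : R ≠ 0) (a : ℕ → ℕ) (ha : ∀ j < m, a j < n)
    (hRa : #((range m).image a) ≤ R) :
    (1 - (Real.exp 1)⁻¹) * ∑ j ∈ range m, (u (a j) j : ℝ) ≤ ∑ j ∈ range m, (cur j : ℝ) := by
  refine le_trans ?_ (h.approx a ha hRa)
  refine mul_le_mul_of_nonneg_right ?_ (by positivity)
  have hR' : (0 : ℝ) < R := by positivity
  have hR1 : (1 : ℝ) ≤ R := by exact_mod_cast Nat.one_le_iff_ne_zero.2 hR
  have hx : 0 ≤ 1 - 1 / (R : ℝ) := by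
    rw [sub_nonneg, div_le_one hR']
    exact hR1
  have : (1 - 1 / (R : ℝ)) ^ R ≤ (Real.exp 1)⁻¹ := by
    calc (1 - 1 / (R : ℝ)) ^ R ≤ (Real.exp (-(1 / (R : ℝ)))) ^ R := by
          gcongr
          have := Real.add_one_le_exp (-(1 / (R : ℝ)))
          linarith
      _ = (Real.exp 1)⁻¹ := by
          rw [← Real.exp_nat_mul, ← Real.exp_neg]
          congr 1
          field_simp
  linarith

/-! ### Pairing the bidders and filling the groups -/

section Grouping

variable (m n K Q : ℕ) (cur own : ℕ → ℕ)

/-- The categories that are assigned to bidder `i`. -/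
def items (i : ℕ) : Finset ℕ := {j ∈ range m | own j = i}

/-- The value that bidder `i` has for the categories assigned to it. -/
def share (i : ℕ) : ℕ := ∑ j ∈ items m own i, cur j

/-- The bidders are paired along their ranks. -/
def pairOf (j : ℕ) : ℕ := rank (range n) (share m cur own) (own j) / 2

/-- The better half of the categories of a bidder go to its pair, if this is among the first `Q`. -/
def Kept (j : ℕ) : Prop :=
  2 * rank (items m own (own j)) cur j < #(items m own (own j)) ∧ pairOf m n cur own j < Q

instance : DecidablePred (Kept m n Q cur own) := fun _ => inferInstanceAs (Decidable (_ ∧ _))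

def keptCount (g : ℕ) : ℕ := #{j ∈ range m | Kept m n Q cur own j ∧ pairOf m n cur own j = g}

/-- The number of categories that the first `g` groups lack. -/
def lack (g : ℕ) : ℕ := ∑ g' ∈ range g, (K - keptCount m n Q cur own g')

/-- The group that is filled up with `j`. -/
def fill (j : ℕ) : ℕ :=
  #{g ∈ range Q | lack m n K Q cur own (g + 1) ≤ Nat.count (fun j => ¬ Kept m n Q cur own j) j}

/-- Discarded categories that remain after all groups are full join group `0`, where they can only
raise the bids. -/
def group (j : ℕ) : ℕ :=
  if Kept m n Q cur own j then pairOf m n cur own j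
  else if fill m n K Q cur own j < Q then fill m n K Q cur own j else 0

theorem exists_count_eq (p : ℕ → Prop) [DecidablePred p] {N t : ℕ} (ht : t < Nat.count p N) :
    ∃ j < N, p j ∧ Nat.count p j = t := by
  induction N with
  | zero => simp at ht
  | succ N ih =>
    by_cases h : t < Nat.count p N
    · obtain ⟨j, hj, h'⟩ := ih h
      exact ⟨j, by omega, h'⟩
    · rw [Nat.count_succ] at ht
      split_ifs at ht with hp
      · exact ⟨N, by omega, hp, by omega⟩
      · omega

variable {m n K Q cur own}

theorem lack_mono : Monotone (lack m n K Q cur own) := fun _ _ h =>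
  sum_le_sum_of_subset (range_mono h)

/-- The discarded categories, numbered from `0`, are dealt out in consecutive intervals: group `g`
receives those with numbers from `lack g` up to but excluding `lack (g + 1)`. -/
theorem fill_eq {j g : ℕ} (hg : g < Q)
    (h₁ : lack m n K Q cur own g ≤ Nat.count (fun j => ¬ Kept m n Q cur own j) j)
    (h₂ : Nat.count (fun j => ¬ Kept m n Q cur own j) j < lack m n K Q cur own (g + 1)) :
    fill m n K Q cur own j = g := by
  rw [fill]
  convert card_range g using 2
  ext g'
  simp only [mem_filter, mem_range]
  refine ⟨fun h => ?_, fun h => ⟨by omega, (lack_mono (by omega : g' + 1 ≤ g)).trans h₁⟩⟩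
  by_contra hlt
  have := lack_mono (m := m) (n := n) (K := K) (Q := Q) (cur := cur) (own := own)
    (by omega : g + 1 ≤ g' + 1)
  omega

/-- At most two bidders have their rank in the pair `g`, and rounding up a half costs one for each.
-/
theorem two_mul_keptCount_le (hown : ∀ j < m, own j < n) (g : ℕ) :
    2 * keptCount m n Q cur own g ≤ #{j ∈ range m | pairOf m n cur own j = g} + 2 := by
  set P : Finset ℕ := {i ∈ range n | rank (range n) (share m cur own) i / 2 = g} with hP
  have hPcard : #P ≤ 2 := by
    have := card_le_card_of_injOn (s := P) (t := {2 * g, 2 * g + 1})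
      (rank (range n) (share m cur own)) (fun i hi => by
        have := (mem_filter.1 hi).2
        simp only [coe_insert, coe_singleton, Set.mem_insert_iff, Set.mem_singleton_iff]
        omega)
      (rank_injOn.mono fun i hi => (mem_filter.1 hi).1)
    exact this.trans card_le_two
  have h₁ : keptCount m n Q cur own g ≤
      ∑ i ∈ P, #{j ∈ items m own i | 2 * rank (items m own i) cur j < #(items m own i)} := by
    rw [keptCount, card_eq_sum_card_fiberwise (f := own) (t := P)]
    · refine sum_le_sum fun i _ => card_le_card fun j hj => ?_
      obtain ⟨hj', rfl⟩ := mem_filter.1 hj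
      obtain ⟨hjm, hk, -⟩ := mem_filter.1 hj'
      exact mem_filter.2 ⟨mem_filter.2 ⟨hjm, rfl⟩, hk.1⟩
    · intro j hj
      obtain ⟨hj, -, h⟩ := mem_filter.1 hj
      exact mem_filter.2 ⟨mem_range.2 (hown j (mem_range.1 hj)), h⟩
  have h₂ : ∑ i ∈ P, #(items m own i) = #{j ∈ range m | pairOf m n cur own j = g} := by
    rw [card_eq_sum_card_fiberwise (f := own) (t := P)]
    · refine sum_congr rfl fun i hi => ?_
      congr 1
      ext j
      rw [items, mem_filter, mem_filter, mem_filter]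
      constructor
      · rintro ⟨hj, rfl⟩
        exact ⟨⟨hj, (mem_filter.1 hi).2⟩, rfl⟩
      · exact fun h => ⟨h.1.1, h.2⟩
    · intro j hj
      obtain ⟨hj, h⟩ := mem_filter.1 hj
      exact mem_filter.2 ⟨mem_range.2 (hown j (mem_range.1 hj)), h⟩
  calc 2 * keptCount m n Q cur own g
      ≤ ∑ i ∈ P, 2 * #{j ∈ items m own i | 2 * rank (items m own i) cur j < #(items m own i)} := by
        rw [← mul_sum]
        exact Nat.mul_le_mul_left _ h₁
    _ ≤ ∑ i ∈ P, (#(items m own i) + 1) := sum_le_sum fun i _ => two_mul_card_rank_le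
    _ ≤ _ := by
        rw [sum_add_distrib, h₂, sum_const, smul_eq_mul, mul_one]
        omega

theorem sum_keptCount_add_count :
    ∑ g ∈ range Q, keptCount m n Q cur own g + Nat.count (fun j => ¬ Kept m n Q cur own j) m
      = m := by
  have h : ∑ g ∈ range Q, keptCount m n Q cur own g = #{j ∈ range m | Kept m n Q cur own j} := by
    rw [card_eq_sum_card_fiberwise (f := pairOf m n cur own) (t := range Q)]
    · exact sum_congr rfl fun g _ => by rw [keptCount, filter_filter]
    · intro j hj
      exact mem_range.2 (mem_filter.1 hj).2.2
  rw [h, Nat.count_eq_card_filter_range]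
  simpa using card_filter_add_card_filter_not (s := range m) (Kept m n Q cur own)

/-- A group needs `max K kept` categories. Twice this is at most `2 * K` plus the number of
categories assigned to the pair: clear if `K` is the maximum, and otherwise by
`two_mul_keptCount_le`, whose rounding term `2` is absorbed since `1 ≤ K`. Summing over the groups
gives at most `2 * Q * K + m ≤ 2 * m`, so kept and missing categories together number at most `m`.
-/
theorem lack_le_count (hown : ∀ j < m, own j < n) (hK : 1 ≤ K) (hQ : 2 * Q * K ≤ m) :
    lack m n K Q cur own Q ≤ Nat.count (fun j => ¬ Kept m n Q cur own j) m := by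
  have h₁ : ∑ g ∈ range Q, #{j ∈ range m | pairOf m n cur own j = g} ≤ m := by
    simp only [card_filter]
    rw [sum_comm]
    refine (sum_le_card_nsmul _ _ 1 fun j _ => ?_).trans (by simp)
    rw [sum_ite_eq]
    split_ifs <;> simp
  have h₂ : ∑ g ∈ range Q, 2 * ((K - keptCount m n Q cur own g) + keptCount m n Q cur own g) ≤
      ∑ g ∈ range Q, (2 * K + #{j ∈ range m | pairOf m n cur own j = g}) :=
    sum_le_sum fun g _ => by
      have := two_mul_keptCount_le (Q := Q) (cur := cur) hown g
      omega
  have h₃ := sum_keptCount_add_count (m := m) (n := n) (Q := Q) (cur := cur) (own := own)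
  rw [← mul_sum, sum_add_distrib, sum_add_distrib, sum_const, card_range, smul_eq_mul] at h₂
  have h₄ : Q * (2 * K) = 2 * Q * K := by ring
  rw [lack]
  omega

/-- Every group gets at least `K` categories. -/
theorem le_card_group (hown : ∀ j < m, own j < n) (hK : 1 ≤ K) (hQ : 2 * Q * K ≤ m) {g : ℕ}
    (hg : g < Q) : K ≤ #{j ∈ range m | group m n K Q cur own j = g} := by
  set p : ℕ → Prop := fun j => ¬ Kept m n Q cur own j
  -- Every number in the interval of group `g` is the number of some discarded category, because the
  -- last interval ends within the supply.
  have h₁ : #(Ico (lack m n K Q cur own g) (lack m n K Q cur own (g + 1))) ≤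
      #{j ∈ range m | p j ∧ group m n K Q cur own j = g} := by
    refine (card_le_card (t := image (Nat.count p) _) fun t ht => ?_).trans card_image_le
    obtain ⟨h₁, h₂⟩ := mem_Ico.1 ht
    obtain ⟨j, hj, hp, rfl⟩ := exists_count_eq p (N := m) (t := t)
      (h₂.trans_le ((lack_mono hg).trans (lack_le_count hown hK hQ)))
    refine mem_image.2 ⟨j, mem_filter.2 ⟨mem_range.2 hj, hp, ?_⟩, rfl⟩
    have := fill_eq hg h₁ h₂
    rw [group, if_neg hp, this, if_pos hg]
  have h₂ : keptCount m n Q cur own g ≤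
      #{j ∈ range m | ¬ p j ∧ group m n K Q cur own j = g} := by
    refine card_le_card fun j hj => ?_
    obtain ⟨hj, hk, h⟩ := mem_filter.1 hj
    exact mem_filter.2 ⟨hj, not_not.2 hk, by rw [group, if_pos hk, h]⟩
  have h₃ := card_filter_add_card_filter_not (s := {j ∈ range m | group m n K Q cur own j = g}) p
  rw [filter_filter, filter_filter] at h₃
  simp only [and_comm (a := group m n K Q cur own _ = g)] at h₃
  rw [Nat.card_Ico, lack, lack, sum_range_succ] at h₁
  omega

theorem group_lt {j : ℕ} (h : 0 < Q) : group m n K Q cur own j < Q := by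
  rw [group]
  split_ifs with h₁ h₂
  exacts [h₁.2, h₂, h]

/-- The members of a pair have at least half of their shares in the group of the pair. -/
theorem share_le_two_mul_sum_group {u : ℕ → ℕ → ℕ} (hcur : ∀ j < m, cur j = u (own j) j) {i g : ℕ}
    (hg : g < Q) (hi : rank (range n) (share m cur own) i / 2 = g) :
    share m cur own i ≤ 2 * ∑ j ∈ range m with group m n K Q cur own j = g, u i j := by
  refine sum_le_two_mul_sum_rank.trans (Nat.mul_le_mul_left _ ?_)
  refine (sum_le_sum (g := u i) fun j hj => ?_).trans (sum_le_sum_of_subset fun j hj => ?_)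
  · obtain ⟨hjm, rfl⟩ := mem_filter.1 (mem_filter.1 hj).1
    exact (hcur j (mem_range.1 hjm)).le
  · obtain ⟨hj, hr⟩ := mem_filter.1 hj
    obtain ⟨hjm, rfl⟩ := mem_filter.1 hj
    have hk : Kept m n Q cur own j := ⟨hr, by rw [pairOf, hi]; exact hg⟩
    exact mem_filter.2 ⟨hjm, by rw [group, if_pos hk, pairOf, hi]⟩

/-- A bidder with nonzero share owns a category, and so does every bidder that comes before it.
Hence a nonzero share of rank `k` requires `k + 1` owners. -/
theorem sorted_share_eq_zero {k : ℕ} (hk : #((range m).image own) ≤ k) :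
    sorted (range n) (share m cur own) k = 0 := by
  by_contra hne
  have hkn : k < #(range n) := by
    by_contra h
    exact hne (sorted_eq_zero (not_lt.1 h))
  obtain ⟨i, hi, rfl⟩ := exists_rank_eq (key := share m cur own) hkn
  rw [sorted_rank hi] at hne
  have hpos : ∀ i, share m cur own i ≠ 0 → i ∈ (range m).image own := by
    intro i h
    obtain ⟨j, hj, -⟩ := exists_ne_zero_of_sum_ne_zero h
    obtain ⟨hjm, rfl⟩ := mem_filter.1 hj
    exact mem_image_of_mem _ hjm
  have : insert i {i' ∈ range n | Before (share m cur own) i' i} ⊆ (range m).image own := by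
    intro i' h
    rcases mem_insert.1 h with rfl | h
    · exact hpos _ hne
    · refine hpos _ ?_
      have := (mem_filter.1 h).2
      simp only [Before] at this
      omega
  have := card_le_card this
  rw [card_insert_of_notMem fun h => by
    have := (mem_filter.1 h).2
    simp [Before] at this] at this
  rw [rank] at hk
  omega

/-- Only the ranks `0, ..., 2 * Q` can have nonzero shares. After the first, they are grouped as `2
* g + 1, 2 * g + 2`, and the second of each two is bounded by the first. -/
theorem sum_cur_le (hown : ∀ j < m, own j < n) (hQ : #((range m).image own) ≤ 2 * Q + 1) :
    ∑ j ∈ range m, cur j ≤ sorted (range n) (share m cur own) 0 +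
      2 * ∑ g ∈ range Q, sorted (range n) (share m cur own) (2 * g + 1) := by
  have h₁ : ∑ j ∈ range m, cur j = ∑ i ∈ range n, share m cur own i :=
    (sum_fiberwise_of_maps_to (fun j hj => mem_range.2 (hown j (mem_range.1 hj))) _).symm
  -- The range is chosen long enough to contain both all ranks and the first `2 * Q + 1` numbers.
  rw [h₁, ← sum_sorted_range (N := n + (2 * Q + 1)) (by simp)]
  have h₂ : ∑ k ∈ range (n + (2 * Q + 1)), sorted (range n) (share m cur own) k =
      ∑ k ∈ range (2 * Q + 1), sorted (range n) (share m cur own) k := by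
    symm
    refine sum_subset (range_mono (by omega)) fun k _ hk => sorted_share_eq_zero ?_
    simp only [mem_range] at hk
    omega
  rw [h₂, sum_range_succ', add_comm]
  refine Nat.add_le_add_left ?_ _
  clear h₂ hQ
  induction Q with
  | zero => simp
  | succ Q ih =>
    rw [show 2 * (Q + 1) = 2 * Q + 1 + 1 by ring, sum_range_succ, sum_range_succ, sum_range_succ]
    have := sorted_antitone (A := range n) (key := share m cur own)
      (by omega : 2 * Q + 1 ≤ 2 * Q + 1 + 1)
    omega

end Grouping

/-! ### The program

The algorithm is deterministic. The bidder with the largest total value is set aside. Greedily, at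
most `m / K` of the other bidders are chosen, and every category is assigned to the one who values
it most. If the second largest total value is at least a fifth of the value of this assignment, then
a single signal is used. Otherwise the bidders are paired by decreasing values of their categories,
each pair gets a signal for the better halves of its categories, and the remaining categories fill
the signals up to `K`. -/

namespace Algorithm

def lt (e₁ e₂ : Expr) : Expr := .op .lt e₁ e₂
def eq (e₁ e₂ : Expr) : Expr := .op .eq e₁ e₂
def lit (c : ℕ) : Expr := .const c
def row : Expr := cell 2
def col : Expr := cell 3
def numCategories : Expr := .read 0 (lit 0)
def numBidders : Expr := .read 0 (lit 1)
def anonymity : Expr := .read 0 (lit 2) + (lit 1 - .read 0 (lit 2))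
def numRounds : Expr := numCategories / anonymity
def numPairs : Expr := numRounds / lit 2
/-- Numerator and denominator of the `t`-th rational number in the input. -/
def num (t : Expr) : Expr := .read 0 (lit 3 + (t + t))
def den (t : Expr) : Expr := .read 0 (lit 4 + (t + t))
/-- The test whether `col` comes before `row` in the order by decreasing entries of array `a`. -/
def before (a : ℕ) : Expr :=
  lt (.read a row) (.read a col) + eq (.read a row) (.read a col) * lt col row

/-- Array `7`: the product of all denominators. -/
def denominators : List Table := [
  ⟨6, lit 1, lit 1, cell 7 * den (cell 5)⟩,
  ⟨7, lit 1, lit 1, cell 6⟩]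

/-- Array `8`: the scaled values; `9`: their sums for each bidder; `10`: the ranks of the bidders by
these sums; `11`: the second largest of the sums; `12`: the scaled values, without those of the
first bidder. -/
def scaling : List Table := [
  ⟨8, numBidders * numCategories, lit 1,
    cell 7 / den (row - row / numCategories * numCategories) / den (numCategories + row) *
      num (row - row / numCategories * numCategories) * num (numCategories + row)⟩,
  ⟨9, numBidders, numCategories, .read 8 (row * numCategories + col)⟩,
  ⟨10, numBidders, numBidders, before 9⟩,
  ⟨11, lit 1, numBidders, .read 9 col * eq (.read 10 col) (lit 1)⟩,
  ⟨12, numBidders * numCategories, lit 1,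
    .read 8 row * lt (lit 0) (.read 10 (row / numCategories))⟩]

/-- Array `13`: the values of the categories for the bidders which they are assigned to; `14`: these
bidders; `15`: the gains of the bidders; `16`: their ranks; `17`: the best bidder. -/
def greedyRound : List Table := [
  ⟨15, numBidders, numCategories, .read 12 (row * numCategories + col) - .read 13 col⟩,
  ⟨16, numBidders, numBidders, before 15⟩,
  ⟨17, lit 1, numBidders, col * eq (.read 16 col) (lit 0)⟩,
  ⟨6, numCategories, lit 1,
    .read 14 row * lt (.read 12 (cell 17 * numCategories + row)) (.read 13 row) +
      cell 17 * eq (lt (.read 12 (cell 17 * numCategories + row)) (.read 13 row)) (lit 0)⟩,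
  ⟨14, numCategories, lit 1, .read 6 row⟩,
  ⟨6, numCategories, lit 1,
    .read 13 row + (.read 12 (cell 17 * numCategories + row) - .read 13 row)⟩,
  ⟨13, numCategories, lit 1, .read 6 row⟩]

/-- Array `18`: the shares of the bidders; `19`: their sum; `20`: the ranks of the bidders; `21`: the
number of categories for each bidder; `22`: the ranks of the categories of each bidder; `23`: the
pairs of bidders; `24`: the kept categories; `25`: their numbers; `26`: the lacks; `27`: the indices
of the categories that are not kept; `28`: the groups which they fill. -/
def grouping : List Table := [
  ⟨18, numBidders, numCategories, .read 13 col * eq (.read 14 col) row⟩,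
  ⟨19, lit 1, numCategories, .read 13 col⟩,
  ⟨20, numBidders, numBidders, before 18⟩,
  ⟨21, numBidders, numCategories, eq (.read 14 col) row⟩,
  ⟨22, numCategories, numCategories, before 13 * eq (.read 14 col) (.read 14 row)⟩,
  ⟨23, numCategories, lit 1, .read 20 (.read 14 row) / lit 2⟩,
  ⟨24, numCategories, lit 1,
    lt (.read 22 row + .read 22 row) (.read 21 (.read 14 row)) * lt (.read 23 row) numPairs⟩,
  ⟨25, numPairs, numCategories, .read 24 col * eq (.read 23 col) row⟩,
  ⟨26, numPairs, numPairs, (anonymity - .read 25 col) * lt col (row + lit 1)⟩,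
  ⟨27, numCategories, numCategories, eq (.read 24 col) (lit 0) * lt col row⟩,
  ⟨28, numCategories, numPairs, lt (.read 26 col) (.read 27 row + lit 1)⟩,
  ⟨1, numCategories, lit 1,
    (.read 23 row * eq (.read 24 row) (lit 1) +
      .read 28 row * eq (.read 24 row) (lit 0) * lt (.read 28 row) numPairs) *
      lt (lit 0) numBidders * lt (cell 11 * lit 5) (cell 19)⟩]

def program : Program :=
  .seq (block [⟨7, lit 1, lit 1, lit 1⟩]) <|
  .seq (rep (numCategories + numBidders * numCategories) (block denominators)) <|
  .seq (block scaling) <|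
  .seq (rep numRounds (block greedyRound)) <|
  block grouping

/-! ### Static properties of the program: safe expressions, loop bounds, valid tables -/

section

variable (e₁ e₂ : Expr) (p : ℕ → Prop)

theorem safe_sub : (e₁ - e₂).Safe ↔ e₁.Safe ∧ e₂.Safe := Iff.rfl
theorem safe_div : (e₁ / e₂).Safe ↔ e₁.Safe ∧ e₂.Safe := Iff.rfl
theorem len_sub : (e₁ - e₂).len = e₁.len + e₂.len + 1 := rfl
theorem len_div : (e₁ / e₂).len = e₁.len + e₂.len + 1 := rfl
theorem only_add : (e₁ + e₂).Only p ↔ e₁.Only p ∧ e₂.Only p := Iff.rfl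
theorem only_sub : (e₁ - e₂).Only p ↔ e₁.Only p ∧ e₂.Only p := Iff.rfl
theorem only_div : (e₁ / e₂).Only p ↔ e₁.Only p ∧ e₂.Only p := Iff.rfl

end

theorem program_safe : program.Safe 1000 := by
  simp [program, denominators, scaling, greedyRound, grouping, block, Table.program, rep, tab,
    tabInner, Program.Safe, before, num, den, numPairs, numRounds, anonymity, numBidders,
    numCategories, row, col, lit, lt, eq, cell, safe_sub, safe_div, len_sub, len_div, Expr.Safe, Expr.Small, Expr.len]

theorem numRounds_le (mem : Memory) : numRounds.val mem ≤ mem 0 0 := Nat.div_le_self _ _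

theorem numPairs_le (mem : Memory) : numPairs.val mem ≤ mem 0 0 :=
  (Nat.div_le_self _ _).trans (numRounds_le mem)

theorem bound_one (mem : Memory) : (lit 1).val mem ≤ scale mem := by
  simp only [lit, Expr.val, scale]; omega

theorem bound_categories (mem : Memory) : numCategories.val mem ≤ scale mem := by
  simp only [numCategories, lit, Expr.val, scale]; omega

theorem bound_bidders (mem : Memory) : numBidders.val mem ≤ scale mem := by
  simp only [numBidders, lit, Expr.val, scale]; omega

theorem bound_entries (mem : Memory) : (numBidders * numCategories).val mem ≤ scale mem := by
  simp only [numBidders, numCategories, lit, Op.apply, Expr.val, scale]; omega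

theorem bound_rationals (mem : Memory) :
    (numCategories + numBidders * numCategories).val mem ≤ scale mem := by
  simp only [numBidders, numCategories, lit, Op.apply, Expr.val, scale]; omega

theorem bound_rounds (mem : Memory) : numRounds.val mem ≤ scale mem :=
  (numRounds_le mem).trans (by simp only [scale]; omega)

theorem bound_pairs (mem : Memory) : numPairs.val mem ≤ scale mem :=
  (numPairs_le mem).trans (by simp only [scale]; omega)

theorem tables_valid (t : Table) (ht : t ∈ ⟨7, lit 1, lit 1, lit 1⟩ :: (denominators ++ scaling ++
    greedyRound ++ grouping)) : t.Valid := by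
  simp only [denominators, scaling, greedyRound, grouping, List.cons_append, List.nil_append,
    List.mem_cons, List.not_mem_nil, or_false] at ht
  rcases ht with rfl | rfl | rfl | rfl | rfl | rfl | rfl | rfl | rfl | rfl | rfl | rfl | rfl |
    rfl | rfl | rfl | rfl | rfl | rfl | rfl | rfl | rfl | rfl | rfl | rfl | rfl | rfl
  all_goals
    constructor
    case rows_le => first
      | exact bound_one | exact bound_categories | exact bound_bidders | exact bound_entries
      | exact bound_pairs
    case cols_le => first
      | exact bound_one | exact bound_categories | exact bound_bidders | exact bound_pairs
    all_goals
      simp [before, num, den, numPairs, numRounds, anonymity, numBidders, numCategories, row, col,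
        lit, lt, eq, cell, only_add, only_sub, only_div, Expr.Only]

def effect (mem : Memory) : Memory :=
  let μ₁ := List.foldl Table.effect mem [⟨7, lit 1, lit 1, lit 1⟩]
  let μ₂ := rounds (fun μ => denominators.foldl Table.effect μ) μ₁
    ((numCategories + numBidders * numCategories).val μ₁)
  let μ₃ := scaling.foldl Table.effect μ₂
  let μ₄ := rounds (fun μ => greedyRound.foldl Table.effect μ) μ₃ (numRounds.val μ₃)
  grouping.foldl Table.effect μ₄

theorem program_computes : Computes program effect := by
  refine (computes_block ?_).seq (((computes_block ?_).rep ?_ bound_rationals ?_).seq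
    ((computes_block ?_).seq (((computes_block ?_).rep ?_ bound_rounds ?_).seq
    (computes_block ?_))))
  case refine_3 => exact ⟨⟨rfl, trivial⟩, ⟨rfl, trivial⟩, rfl, trivial⟩
  case refine_7 =>
    exact ⟨⟨rfl, trivial⟩, ⟨rfl, trivial⟩, trivial, rfl, trivial⟩
  case refine_4 | refine_8 =>
    intro mem
    simp [denominators, greedyRound, Table.effect_of_ne]
  all_goals
    intro t ht
    refine tables_valid t ?_
    simp only [List.mem_cons, List.mem_append]
    try simp only [List.mem_singleton] at ht
    tauto

end Algorithm

/-! ### Symbolic execution of the tables -/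

/-- A proof rule for one tabulation: the new memory is known only through a frame condition and the
entries of the filled array. This keeps the terms small when long lists are executed. -/
theorem Table.foldl_cons {t : Table} {l : List Table} {mem : Memory} {C : Memory → Prop}
    (h : ∀ mem', (∀ b, b ≠ t.array → mem' b = mem b) →
      (∀ x < t.rows.val mem, mem' t.array x =
        ∑ y ∈ range (t.cols.val mem), t.entry.val (setIndices mem x y)) →
      C (l.foldl Table.effect mem')) : C ((t :: l).foldl Table.effect mem) :=
  h _ (fun _ hb => effect_of_ne hb _) fun _ hx => effect_array hx

theorem setIndices_two (mem : Memory) (x y : ℕ) : setIndices mem x y 2 0 = x := by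
  simp [setIndices, Memory.write_apply]

theorem setIndices_three (mem : Memory) (x y : ℕ) : setIndices mem x y 3 0 = y := by
  simp [setIndices, Memory.write_apply]

theorem setIndices_of_ne {b : ℕ} (h₂ : b ≠ 2) (h₃ : b ≠ 3) (mem : Memory) (x y : ℕ) :
    setIndices mem x y b = mem b := by
  rw [setIndices, Memory.write_of_ne _ h₃, Memory.write_of_ne _ h₂]

namespace Algorithm

section Values

variable (mem : Memory) (x y : ℕ) (e₁ e₂ : Expr)

theorem row_val : row.val (setIndices mem x y) = x := setIndices_two _ _ _
theorem col_val : col.val (setIndices mem x y) = y := setIndices_three _ _ _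
theorem lit_val (c : ℕ) : (lit c).val mem = c := rfl
theorem numCategories_val : numCategories.val mem = mem 0 0 := rfl
theorem numBidders_val : numBidders.val mem = mem 0 1 := rfl
theorem anonymity_val : anonymity.val mem = mem 0 2 + (1 - mem 0 2) := rfl
theorem numRounds_val : numRounds.val mem = mem 0 0 / (mem 0 2 + (1 - mem 0 2)) := rfl
theorem numPairs_val : numPairs.val mem = mem 0 0 / (mem 0 2 + (1 - mem 0 2)) / 2 := rfl
theorem lt_val : (lt e₁ e₂).val mem = if e₁.val mem < e₂.val mem then 1 else 0 := rfl
theorem eq_val : (eq e₁ e₂).val mem = if e₁.val mem = e₂.val mem then 1 else 0 := rfl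
theorem read_val (a : ℕ) : (Expr.read a e₁).val mem = mem a (e₁.val mem) := rfl
theorem num_val : (num e₁).val mem = mem 0 (3 + (e₁.val mem + e₁.val mem)) := rfl
theorem den_val : (den e₁).val mem = mem 0 (4 + (e₁.val mem + e₁.val mem)) := rfl

theorem before_val {a : ℕ} (h₂ : a ≠ 2) (h₃ : a ≠ 3) :
    (before a).val (setIndices mem x y) = (if mem a x < mem a y then 1 else 0) +
      (if mem a x = mem a y then 1 else 0) * (if y < x then 1 else 0) := by
  simp only [before, add_val, mul_val, lt_val, eq_val, read_val, row_val, col_val,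
    setIndices_of_ne h₂ h₃]

end Values

theorem ite_mul_ite_eq (p q : Prop) [Decidable p] [Decidable q] [Decidable (p ∧ q)] :
    (if p then 1 else 0) * (if q then 1 else 0) = if p ∧ q then 1 else (0 : ℕ) := by
  by_cases hp : p <;> by_cases hq : q <;> simp [hp, hq]

theorem ite_eq_zero_mul_ite_eq (p q : Prop) [Decidable p] [Decidable q] [Decidable (q ∧ ¬ p)] :
    (if (if p then 1 else 0) = 0 then 1 else 0) * (if q then 1 else 0) =
      if q ∧ ¬ p then 1 else (0 : ℕ) := by
  by_cases hp : p <;> by_cases hq : q <;> simp [hp, hq]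

theorem grouping_spec {m n K Q : ℕ} {cur own : ℕ → ℕ} {μ : Memory} (hm : μ 0 0 = m)
    (hn : μ 0 1 = n) (hK : μ 0 2 + (1 - μ 0 2) = K) (hQ : m / K / 2 = Q)
    (hown : 0 < n → ∀ j < m, own j < n) (hcur : μ 13 = cur) (hown' : μ 14 = own) {j : ℕ}
    (hj : j < m) :
    grouping.foldl Table.effect μ 1 j =
      if 0 < n ∧ 5 * μ 11 0 < ∑ j ∈ range m, cur j then group m n K Q cur own j else 0 := by
  let C : Memory → Prop := fun ν => ν 1 j =
    if 0 < n ∧ 5 * μ 11 0 < ∑ j ∈ range m, cur j then group m n K Q cur own j else 0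
  change C (grouping.foldl Table.effect μ)
  unfold grouping
  have aux : ∀ b : ℕ, b ≠ 2 → b ≠ 3 → ∀ (mem : Memory) x y, setIndices mem x y b = mem b :=
    fun b h₂ h₃ => setIndices_of_ne h₂ h₃
  -- From here on, each `f` says which arrays a table leaves alone and each `e` gives the entries it
  -- writes; earlier frames rewrite later entries back to the memory in which an array was last
  -- filled.
  refine Table.foldl_cons fun μ₁ f₁ e₁ => ?_
  dsimp only at f₁ e₁
  simp (discharger := decide) only [numBidders_val, numCategories_val, mul_val, eq_val, read_val,
    row_val, col_val, aux, hm, hn, hcur, hown'] at e₁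
  refine Table.foldl_cons fun μ₂ f₂ e₂ => ?_
  dsimp only at f₂ e₂
  simp (discharger := decide) only [numCategories_val, read_val, col_val, lit_val, aux, hm, hcur,
    f₁] at e₂
  refine Table.foldl_cons fun μ₃ f₃ e₃ => ?_
  dsimp only at f₃ e₃
  simp (discharger := decide) only [numBidders_val, before_val, hn, sum_before, f₂, f₁] at e₃
  refine Table.foldl_cons fun μ₄ f₄ e₄ => ?_
  dsimp only at f₄ e₄
  simp (discharger := decide) only [numBidders_val, numCategories_val, eq_val, read_val,
    row_val, col_val, aux, hm, hn, hown', f₃, f₂, f₁] at e₄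
  refine Table.foldl_cons fun μ₅ f₅ e₅ => ?_
  dsimp only at f₅ e₅
  simp (discharger := decide) only [numCategories_val, mul_val, before_val, eq_val, read_val,
    row_val, col_val, aux, hm, hcur, hown', f₄, f₃, f₂, f₁] at e₅
  refine Table.foldl_cons fun μ₆ f₆ e₆ => ?_
  dsimp only at f₆ e₆
  simp (discharger := decide) only [numCategories_val, div_val, read_val, row_val, lit_val, aux, hm,
    hown', f₅, f₄, f₃, f₂, f₁, sum_range_one] at e₆
  refine Table.foldl_cons fun μ₇ f₇ e₇ => ?_
  dsimp only at f₇ e₇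
  simp (discharger := decide) only [numCategories_val, numPairs_val, add_val, mul_val, lt_val,
    read_val, row_val, lit_val, aux, hm, hK, hQ, hown', f₆, f₅, f₄, f₃, f₂, f₁, sum_range_one] at e₇
  refine Table.foldl_cons fun μ₈ f₈ e₈ => ?_
  dsimp only at f₈ e₈
  simp (discharger := decide) only [numCategories_val, numPairs_val, mul_val, eq_val, read_val,
    row_val, col_val, aux, hm, hK, hQ, f₇, f₆, f₅, f₄, f₃, f₂, f₁] at e₈
  refine Table.foldl_cons fun μ₉ f₉ e₉ => ?_
  dsimp only at f₉ e₉
  simp (discharger := decide) only [anonymity_val, numPairs_val, add_val, sub_val, mul_val, lt_val,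
    read_val, row_val, col_val, lit_val, aux, hm, hK, hQ, f₈, f₇, f₆, f₅, f₄, f₃, f₂, f₁] at e₉
  refine Table.foldl_cons fun μ₁₀ f₁₀ e₁₀ => ?_
  dsimp only at f₁₀ e₁₀
  simp (discharger := decide) only [numCategories_val, mul_val, lt_val, eq_val, read_val, row_val,
    col_val, lit_val, aux, hm, f₉, f₈, f₇, f₆, f₅, f₄, f₃, f₂, f₁] at e₁₀
  refine Table.foldl_cons fun μ₁₁ f₁₁ e₁₁ => ?_
  dsimp only at f₁₁ e₁₁
  simp (discharger := decide) only [numCategories_val, numPairs_val, add_val, lt_val, read_val,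
    row_val, col_val, lit_val, aux, hm, hK, hQ, f₁₀, f₉, f₈, f₇, f₆, f₅, f₄, f₃, f₂, f₁] at e₁₁
  refine Table.foldl_cons fun μ₁₂ f₁₂ e₁₂ => ?_
  dsimp only at f₁₂ e₁₂
  simp (discharger := decide) only [numCategories_val, numBidders_val, numPairs_val, add_val,
    mul_val, lt_val, eq_val, read_val, cell_val, row_val, lit_val, aux, hm, hn, hK, hQ, f₁₁, f₁₀,
    f₉, f₈, f₇, f₆, f₅, f₄, f₃, f₂, f₁, sum_range_one] at e₁₂
  clear f₁ f₂ f₃ f₄ f₅ f₆ f₇ f₈ f₉ f₁₀ f₁₁ f₁₂ aux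
  change μ₁₂ 1 j = _
  rw [e₁₂ j hj]
  -- Without bidders `own` need not be in range, but then the factor `lt (lit 0) numBidders` makes
  -- the output zero.
  by_cases hn0 : 0 < n
  swap
  · simp [hn0]
  specialize hown hn0
  have g₁ : ∀ i < n, μ₁ 18 i = share m cur own i := fun i hi => by
    simp only [e₁ i hi, share, items, sum_filter, mul_ite, mul_one, mul_zero]
  have g₅ : ∀ j < m, μ₅ 22 j = rank (items m own (own j)) cur j := fun j hj => by
    rw [e₅ j hj, ← sum_before, items, sum_filter]
    exact sum_congr rfl fun y _ => by split_ifs <;> simp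
  have g₆ : ∀ j < m, μ₆ 23 j = pairOf m n cur own j := fun j hj => by
    rw [e₆ j hj, e₃ _ (hown j hj), pairOf, rank_congr (fun i hi => g₁ i (mem_range.1 hi))
      (mem_range.2 (hown j hj))]
  have g₇ : ∀ j < m, μ₇ 24 j = if Kept m n Q cur own j then 1 else 0 := fun j hj => by
    rw [e₇ j hj, g₅ j hj, g₆ j hj, e₄ _ (hown j hj), ← two_mul, ← card_filter,
      ← show items m own (own j) = {y ∈ range m | own y = own j} from rfl]
    by_cases h : Kept m n Q cur own j
    · rw [if_pos h, if_pos h.1, if_pos h.2]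
    · rw [if_neg h]
      by_cases h' : 2 * rank (items m own (own j)) cur j < #(items m own (own j))
      · rw [if_neg fun h'' => h ⟨h', h''⟩, mul_zero]
      · rw [if_neg h', zero_mul]
  have g₈ : ∀ g < Q, μ₈ 25 g = keptCount m n Q cur own g := fun g hg => by
    rw [e₈ g hg, keptCount, card_filter]
    refine sum_congr rfl fun y hy => ?_
    rw [g₇ y (mem_range.1 hy), g₆ y (mem_range.1 hy), ite_mul_ite_eq]
  have g₉ : ∀ g < Q, μ₉ 26 g = lack m n K Q cur own (g + 1) := fun g hg => by
    have : range (g + 1) = {y ∈ range Q | y < g + 1} := by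
      ext y
      simp only [mem_filter, mem_range]
      omega
    rw [e₉ g hg, lack, this, sum_filter]
    refine sum_congr rfl fun y hy => ?_
    rw [g₈ y (mem_range.1 hy)]
    split_ifs <;> simp
  have g₁₀ : ∀ j < m, μ₁₀ 27 j = Nat.count (fun j => ¬ Kept m n Q cur own j) j := fun j hj => by
    have : range j = {y ∈ range m | y < j} := by
      ext y
      simp only [mem_filter, mem_range]
      omega
    rw [e₁₀ j hj, Nat.count_eq_card_filter_range, this, filter_filter, card_filter]
    refine sum_congr rfl fun y hy => ?_
    rw [g₇ y (mem_range.1 hy), ite_eq_zero_mul_ite_eq]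
  have g₁₁ : μ₁₁ 28 j = fill m n K Q cur own j := by
    rw [e₁₁ j hj, fill, card_filter]
    refine sum_congr rfl fun y hy => ?_
    rw [g₉ y (mem_range.1 hy), g₁₀ j hj]
    simp only [Nat.lt_succ_iff]
  rw [g₆ j hj, g₇ j hj, g₁₁, e₂ 0 Nat.one_pos, group, mul_comm (μ 11 0)]
  clear * - hn0
  by_cases h₁ : 5 * μ 11 0 < ∑ j ∈ range m, cur j <;> by_cases h₂ : Kept m n Q cur own j <;>
    by_cases h₃ : fill m n K Q cur own j < Q <;> simp [h₁, h₂, h₃, hn0]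

/-! ### The phases before the grouping -/

/-- The best bidder is the one of rank `0` by gain. The owners are updated before the values, since
their update compares with the old values; array `6` is scratch because a table must not read the
array it fills. -/
theorem greedyRound_spec {m n : ℕ} {cur own : ℕ → ℕ} {μ : Memory} (hm : μ 0 0 = m)
    (hn : μ 0 1 = n) (hcur : μ 13 = cur) (hown : μ 14 = own) (hn0 : 0 < n) :
    ∃ b < n, (∀ i < n, gain m (fun i j => μ 12 (i * m + j)) cur i ≤
        gain m (fun i j => μ 12 (i * m + j)) cur b) ∧
      (∀ j < m, greedyRound.foldl Table.effect μ 13 j = cur j + (μ 12 (b * m + j) - cur j)) ∧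
      (∀ j < m, greedyRound.foldl Table.effect μ 14 j =
        if μ 12 (b * m + j) < cur j then own j else b) := by
  let C : Memory → Prop := fun ν =>
    ∃ b < n, (∀ i < n, gain m (fun i j => μ 12 (i * m + j)) cur i ≤
        gain m (fun i j => μ 12 (i * m + j)) cur b) ∧
      (∀ j < m, ν 13 j = cur j + (μ 12 (b * m + j) - cur j)) ∧
      (∀ j < m, ν 14 j = if μ 12 (b * m + j) < cur j then own j else b)
  change C (greedyRound.foldl Table.effect μ)
  unfold greedyRound
  have aux : ∀ b : ℕ, b ≠ 2 → b ≠ 3 → ∀ (mem : Memory) x y, setIndices mem x y b = mem b :=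
    fun b h₂ h₃ => setIndices_of_ne h₂ h₃
  refine Table.foldl_cons fun μ₁ f₁ e₁ => ?_
  dsimp only at f₁ e₁
  simp (discharger := decide) only [numBidders_val, numCategories_val, add_val, sub_val, mul_val,
    read_val, row_val, col_val, aux, hm, hn, hcur] at e₁
  refine Table.foldl_cons fun μ₂ f₂ e₂ => ?_
  dsimp only at f₂ e₂
  simp (discharger := decide) only [numBidders_val, before_val, hn, sum_before, f₁] at e₂
  refine Table.foldl_cons fun μ₃ f₃ e₃ => ?_
  dsimp only at f₃ e₃
  simp (discharger := decide) only [numBidders_val, mul_val, eq_val, read_val,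
    col_val, lit_val, aux, hn, f₂, f₁] at e₃
  refine Table.foldl_cons fun μ₄ f₄ e₄ => ?_
  dsimp only at f₄ e₄
  simp (discharger := decide) only [numCategories_val, add_val, mul_val, lt_val, eq_val, read_val,
    row_val, cell_val, lit_val, aux, hm, hcur, hown, f₃, f₂, f₁, sum_range_one] at e₄
  refine Table.foldl_cons fun μ₅ f₅ e₅ => ?_
  dsimp only at f₅ e₅
  simp (discharger := decide) only [numCategories_val, read_val, row_val, lit_val, aux, hm, f₄, f₃,
    f₂, f₁, sum_range_one] at e₅
  refine Table.foldl_cons fun μ₆ f₆ e₆ => ?_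
  dsimp only at f₆ e₆
  simp (discharger := decide) only [numCategories_val, add_val, sub_val, mul_val, read_val, row_val,
    cell_val, lit_val, aux, hm, hcur, f₅, f₄, f₃, f₂, f₁, sum_range_one] at e₆
  refine Table.foldl_cons fun μ₇ f₇ e₇ => ?_
  dsimp only at f₇ e₇
  simp (discharger := decide) only [numCategories_val, read_val, row_val, lit_val, aux, hm, f₆, f₅,
    f₄, f₃, f₂, f₁, sum_range_one] at e₇
  change C μ₇
  have g₁ : ∀ i < n, μ₁ 15 i = gain m (fun i j => μ 12 (i * m + j)) cur i := e₁
  obtain ⟨b, hb, hrb⟩ := exists_rank_eq (A := range n) (key := μ₁ 15) (k := 0) (by simpa using hn0)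
  have hbest : μ₃ 17 0 = b := by
    rw [e₃ 0 Nat.one_pos, ← sum_mul_rank_eq (A := range n) (key := μ₁ 15) (fun i => i) hb, hrb]
    exact sum_congr rfl fun i hi => by rw [e₂ i (mem_range.1 hi)]
  rw [hbest] at e₄ e₆
  refine ⟨b, mem_range.1 hb, fun i hi => ?_, fun j hj => ?_, fun j hj => ?_⟩
  · rw [← g₁ i hi, ← g₁ b (mem_range.1 hb)]
    exact key_le_of_rank_le (mem_range.2 hi) (by omega)
  · rw [e₇ j hj, e₆ j hj]
  · rw [f₇ 14 (by decide), f₆ 14 (by decide), e₅ j hj, e₄ j hj]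
    split_ifs <;> simp_all

end Algorithm

theorem Table.foldl_of_notMem {l : List Table} {b : ℕ} (h : b ∉ l.map Table.array) (mem : Memory) :
    l.foldl Table.effect mem b = mem b := by
  induction l generalizing mem with
  | nil => rfl
  | cons t l ih =>
    simp only [List.map_cons, List.mem_cons, not_or] at h
    rw [List.foldl_cons, ih h.2, effect_of_ne h.1]

theorem rounds_induction {F : Memory → Memory} {mem : Memory} (p : ℕ → Memory → Prop)
    (zero : p 0 (mem.write 5 0 0))
    (succ : ∀ i μ, μ 5 0 = i → p i μ → p (i + 1) ((F μ).write 5 0 (i + 1))) (i : ℕ) :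
    p i (rounds F mem i) := by
  suffices H : p i (rounds F mem i) ∧ rounds F mem i 5 0 = i from H.1
  induction i with
  | zero => exact ⟨zero, Memory.write_same _ _ _ _⟩
  | succ i ih => exact ⟨succ i _ ih.2 ih.1, Memory.write_same _ _ _ _⟩

namespace Algorithm

/-- Array `13` is tracked as well, because the greedy rounds rely on its still being zero. -/
theorem denominators_spec (mem : Memory) (i : ℕ) :
    let μ := rounds (fun μ => denominators.foldl Table.effect μ)
      (List.foldl Table.effect mem [⟨7, lit 1, lit 1, lit 1⟩]) i
    μ 7 0 = ∏ t ∈ range i, mem 0 (4 + (t + t)) ∧ μ 0 = mem 0 ∧ μ 13 = mem 13 := by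
  refine rounds_induction (fun i μ => μ 7 0 = ∏ t ∈ range i, mem 0 (4 + (t + t)) ∧
    μ 0 = mem 0 ∧ μ 13 = mem 13) ?_ ?_ i
  · rw [Memory.write_of_ne _ (by decide), Memory.write_of_ne _ (by decide),
      Memory.write_of_ne _ (by decide), Table.foldl_of_notMem (b := 0) (by simp),
      Table.foldl_of_notMem (b := 13) (by simp)]
    refine ⟨?_, rfl, rfl⟩
    rw [List.foldl_cons, List.foldl_nil,
      Table.effect_array (t := ⟨7, lit 1, lit 1, lit 1⟩) (show 0 < 1 from Nat.one_pos)]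
    simp [lit_val]
  · rintro i μ hi ⟨h₇, h₀, h₁₃⟩
    rw [Memory.write_of_ne _ (by decide), Memory.write_of_ne _ (by decide),
      Memory.write_of_ne _ (by decide), Table.foldl_of_notMem (b := 0) (by simp [denominators]),
      Table.foldl_of_notMem (b := 13) (by simp [denominators])]
    refine ⟨?_, h₀, h₁₃⟩
    let C : Memory → Prop := fun ν => ν 7 0 = ∏ t ∈ range (i + 1), mem 0 (4 + (t + t))
    change C (denominators.foldl Table.effect μ)
    unfold denominators
    refine Table.foldl_cons fun μ₁ f₁ e₁ => ?_
    dsimp only at f₁ e₁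
    simp (discharger := decide) only [lit_val, mul_val, cell_val, den_val, setIndices_of_ne,
      sum_range_one] at e₁
    refine Table.foldl_cons fun μ₂ f₂ e₂ => ?_
    dsimp only at f₂ e₂
    simp (discharger := decide) only [lit_val, cell_val, setIndices_of_ne, sum_range_one] at e₂
    change μ₂ 7 0 = _
    rw [e₂ 0 Nat.one_pos, e₁ 0 Nat.one_pos, prod_range_succ, h₇, h₀, hi]

/-- The matrices are stored row by row, so division by `m` recovers the bidder from the position `i
* m + j` and subtraction the category. -/
theorem scaling_spec {m n : ℕ} {μ : Memory} (hm : μ 0 0 = m) (hn : μ 0 1 = n)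
    {w : ℕ → ℕ → ℕ} {V : ℕ → ℕ} (hw : ∀ i < n, ∀ j < m, w i j = μ 7 0 / μ 0 (4 + (j + j)) /
      μ 0 (4 + (m + (i * m + j) + (m + (i * m + j)))) * μ 0 (3 + (j + j)) *
      μ 0 (3 + (m + (i * m + j) + (m + (i * m + j)))))
    (hV : ∀ i < n, V i = ∑ j ∈ range m, w i j) :
    scaling.foldl Table.effect μ 11 0 =
        ∑ i ∈ range n, V i * (if rank (range n) V i = 1 then 1 else 0) ∧
      ∀ i < n, ∀ j < m, scaling.foldl Table.effect μ 12 (i * m + j) =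
        w i j * if 0 < rank (range n) V i then 1 else 0 := by
  let C : Memory → Prop := fun ν => ν 11 0 =
        ∑ i ∈ range n, V i * (if rank (range n) V i = 1 then 1 else 0) ∧
      ∀ i < n, ∀ j < m, ν 12 (i * m + j) = w i j * if 0 < rank (range n) V i then 1 else 0
  change C (scaling.foldl Table.effect μ)
  unfold scaling
  have aux : ∀ b : ℕ, b ≠ 2 → b ≠ 3 → ∀ (mem : Memory) x y, setIndices mem x y b = mem b :=
    fun b h₂ h₃ => setIndices_of_ne h₂ h₃
  refine Table.foldl_cons fun μ₁ f₁ e₁ => ?_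
  dsimp only at f₁ e₁
  simp (discharger := decide) only [numBidders_val, numCategories_val, add_val, sub_val, mul_val,
    div_val, num_val, den_val, cell_val, row_val, lit_val, aux, hm, hn, sum_range_one] at e₁
  refine Table.foldl_cons fun μ₂ f₂ e₂ => ?_
  dsimp only at f₂ e₂
  simp (discharger := decide) only [numBidders_val, numCategories_val, add_val, mul_val, read_val,
    row_val, col_val, aux, hm, hn, f₁] at e₂
  refine Table.foldl_cons fun μ₃ f₃ e₃ => ?_
  dsimp only at f₃ e₃
  simp (discharger := decide) only [numBidders_val, before_val, hn, sum_before, f₂, f₁] at e₃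
  refine Table.foldl_cons fun μ₄ f₄ e₄ => ?_
  dsimp only at f₄ e₄
  simp (discharger := decide) only [numBidders_val, mul_val, eq_val, read_val, col_val, lit_val,
    aux, hn, f₃, f₂, f₁] at e₄
  refine Table.foldl_cons fun μ₅ f₅ e₅ => ?_
  dsimp only at f₅ e₅
  simp (discharger := decide) only [numBidders_val, numCategories_val, mul_val, div_val, lt_val,
    read_val, row_val, lit_val, aux, hm, hn, f₄, f₃, f₂, f₁, sum_range_one] at e₅
  change C μ₅
  have hlt : ∀ i < n, ∀ j < m, i * m + j < n * m := fun i hi j hj => by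
    calc i * m + j < i * m + m := by omega
      _ = (i + 1) * m := by ring
      _ ≤ n * m := Nat.mul_le_mul_right _ hi
  have hdiv : ∀ i, ∀ j < m, (i * m + j) / m = i := fun i j hj => by
    rw [mul_comm, Nat.mul_add_div (by omega), Nat.div_eq_of_lt hj, add_zero]
  have g₁ : ∀ i < n, ∀ j < m, μ₁ 8 (i * m + j) = w i j := fun i hi j hj => by
    rw [e₁ _ (hlt i hi j hj), hw i hi j hj, hdiv i j hj, Nat.add_sub_cancel_left]
  have g₂ : ∀ i < n, μ₂ 9 i = V i := fun i hi => by
    rw [e₂ i hi, hV i hi]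
    exact sum_congr rfl fun j hj => g₁ i hi j (mem_range.1 hj)
  have g₃ : ∀ i < n, μ₃ 10 i = rank (range n) V i := fun i hi => by
    rw [e₃ i hi, rank_congr (fun i hi => g₂ i (mem_range.1 hi)) (mem_range.2 hi)]
  refine ⟨?_, fun i hi j hj => ?_⟩
  · rw [f₅ 11 (by decide), e₄ 0 Nat.one_pos]
    exact sum_congr rfl fun i hi => by rw [g₂ i (mem_range.1 hi), g₃ i (mem_range.1 hi)]
  · rw [e₅ _ (hlt i hi j hj), hdiv i j hj, g₁ i hi j hj, g₃ i hi]

theorem greedy_spec {m n : ℕ} {μ : Memory} {u : ℕ → ℕ → ℕ} (hm : μ 0 0 = m) (hn : μ 0 1 = n)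
    (hn0 : 0 < n) (hu : ∀ i < n, ∀ j < m, μ 12 (i * m + j) = u i j) (hcur : μ 13 = 0) {R : ℕ}
    (hR : R ≠ 0) (k : ℕ) :
    let ν := rounds (fun μ => greedyRound.foldl Table.effect μ) μ k
    GreedyInv m n R u k (ν 13) (ν 14) := by
  refine (rounds_induction (fun k ν => GreedyInv m n R u k (ν 13) (ν 14) ∧ ν 0 = μ 0 ∧
    ν 12 = μ 12) ?_ ?_ k).1
  · rw [Memory.write_of_ne _ (by decide), Memory.write_of_ne _ (by decide),
      Memory.write_of_ne _ (by decide), Memory.write_of_ne _ (by decide)]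
    exact ⟨.zero _ _ _ _ _ _ (by simp [hcur]), rfl, rfl⟩
  · rintro k ν - ⟨h, h₀, h₁₂⟩
    rw [Memory.write_of_ne _ (by decide), Memory.write_of_ne _ (by decide),
      Memory.write_of_ne _ (by decide), Memory.write_of_ne _ (by decide),
      Table.foldl_of_notMem (b := 0) (by simp [greedyRound]),
      Table.foldl_of_notMem (b := 12) (by simp [greedyRound])]
    refine ⟨?_, h₀, h₁₂⟩
    obtain ⟨b, hb, hmax, hc, ho⟩ := greedyRound_spec (μ := ν) (m := m) (n := n) (by rw [h₀, hm])
      (by rw [h₀, hn]) rfl rfl hn0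
    have hgain : ∀ i < n, gain m (fun i j => ν 12 (i * m + j)) (ν 13) i = gain m u (ν 13) i :=
      fun i hi => sum_congr rfl fun j hj => by
        dsimp only
        rw [h₁₂, hu i hi j (mem_range.1 hj)]
    refine h.succ hR hb (fun i hi => ?_) (fun j hj => ?_) fun j hj => ?_
    · rw [← hgain i hi, ← hgain b hb]
      exact hmax i hi
    · rw [hc j hj, h₁₂, hu b hb j hj]
    · rw [ho j hj, h₁₂, hu b hb j hj]

/-- What the program does, in terms of the entries of its input. -/
theorem effect_spec {m n K R Q : ℕ} {mem : Memory} (hm : mem 0 0 = m) (hn : mem 0 1 = n)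
    (hK : mem 0 2 + (1 - mem 0 2) = K) (hR : m / K = R) (hR0 : R ≠ 0) (hQ : R / 2 = Q)
    (h13 : mem 13 = 0) {D : ℕ} (hD : D = ∏ t ∈ range (m + n * m), mem 0 (4 + (t + t)))
    {w : ℕ → ℕ → ℕ} {V : ℕ → ℕ} (hw : ∀ i < n, ∀ j < m, w i j = D / mem 0 (4 + (j + j)) /
      mem 0 (4 + (m + (i * m + j) + (m + (i * m + j)))) * mem 0 (3 + (j + j)) *
      mem 0 (3 + (m + (i * m + j) + (m + (i * m + j)))))
    (hV : ∀ i < n, V i = ∑ j ∈ range m, w i j) :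
    ∃ cur own : ℕ → ℕ, (0 < n → GreedyInv m n R
        (fun i j => w i j * if 0 < rank (range n) V i then 1 else 0) R cur own) ∧
      ∀ j < m, effect mem 1 j = if 0 < n ∧
          5 * ∑ i ∈ range n, V i * (if rank (range n) V i = 1 then 1 else 0) <
            ∑ j ∈ range m, cur j
        then group m n K Q cur own j else 0 := by
  simp only [effect]
  have hdims : (numCategories + numBidders * numCategories).val
      (List.foldl Table.effect mem [⟨7, lit 1, lit 1, lit 1⟩]) = m + n * m := by
    rw [add_val, mul_val, numCategories_val, numBidders_val, Table.foldl_of_notMem (by simp), hm,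
      hn]
  rw [hdims]
  obtain ⟨d₇, d₀, d₁₃⟩ := denominators_spec mem (m + n * m)
  generalize rounds (fun μ => denominators.foldl Table.effect μ)
      (List.foldl Table.effect mem [⟨7, lit 1, lit 1, lit 1⟩]) (m + n * m) = μ₂ at *
  rw [← hD] at d₇
  obtain ⟨s₁₁, s₁₂⟩ := scaling_spec (μ := μ₂) (m := m) (n := n) (w := w) (V := V) (by rw [d₀, hm])
    (by rw [d₀, hn]) (by rw [d₀, d₇]; exact hw) hV
  have s₀ : scaling.foldl Table.effect μ₂ 0 = mem 0 := by
    rw [Table.foldl_of_notMem (by simp [scaling]), d₀]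
  have s₁₃ : scaling.foldl Table.effect μ₂ 13 = 0 := by
    rw [Table.foldl_of_notMem (by simp [scaling]), d₁₃, h13]
  generalize scaling.foldl Table.effect μ₂ = μ₃ at *
  have hrounds : numRounds.val μ₃ = R := by rw [numRounds_val, s₀, hm, hK, hR]
  rw [hrounds]
  have hframe : ∀ b, b = 0 ∨ b = 11 →
      rounds (fun μ => greedyRound.foldl Table.effect μ) μ₃ R b = μ₃ b := by
    intro b hb
    refine rounds_induction (fun _ ν => ν b = μ₃ b) (Memory.write_of_ne _ (by omega) _ _)
      (fun i ν _ hν => ?_) R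
    rw [Memory.write_of_ne _ (by omega), Table.foldl_of_notMem, hν]
    rcases hb with rfl | rfl <;> simp [greedyRound]
  have hinv := fun hn0 : 0 < n => greedy_spec (μ := μ₃) (m := m) (n := n) (by rw [s₀, hm])
    (by rw [s₀, hn]) hn0 s₁₂ s₁₃ hR0 R
  have f₀ := hframe 0 (Or.inl rfl)
  have f₁₁ := hframe 11 (Or.inr rfl)
  generalize rounds (fun μ => greedyRound.foldl Table.effect μ) μ₃ R = μ₄ at *
  refine ⟨μ₄ 13, μ₄ 14, hinv, fun j hj => ?_⟩
  rw [grouping_spec (μ := μ₄) (m := m) (n := n) (K := K) (Q := Q) (by rw [f₀, s₀, hm])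
    (by rw [f₀, s₀, hn]) (by rw [f₀, s₀, hK]) (by rw [hR, hQ])
    (fun hn0 j hj => ((hinv hn0).cur_eq hR0 j hj).1) rfl rfl hj, f₁₁, s₁₁]

end Algorithm

/-! ### Revenue -/

theorem secondHighest_mul {n : ℕ} (c : NNRat) (x : Fin n → NNRat) :
    c * secondHighest x = secondHighest fun i => c * x i := by
  rw [secondHighest, secondHighest]
  rw [apply_sup_eq_sup_comp (c * ·) (fun a b => mul_max_of_nonneg a b zero_le) (mul_zero c)]
  exact sup_congr rfl fun q _ => mul_min_of_nonneg _ _ zero_le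

theorem le_secondHighest {n : ℕ} {x : Fin n → NNRat} {i i' : Fin n} (h : i ≠ i') {a : NNRat}
    (hi : a ≤ x i) (hi' : a ≤ x i') : a ≤ secondHighest x := by
  have h' := le_sup (f := fun q : Fin n × Fin n => min (x q.1) (x q.2))
    (show (i, i') ∈ (univ : Finset (Fin n)).offDiag by simp [h])
  exact (le_min hi hi').trans h'

/-- Off any given bidder, some bidder reaches the second highest value. -/
theorem exists_secondHighest_le {n : ℕ} (x : Fin n → NNRat) (top : Fin n) :
    secondHighest x = 0 ∨ ∃ i, i ≠ top ∧ secondHighest x ≤ x i := by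
  rcases (univ : Finset (Fin n)).offDiag.eq_empty_or_nonempty with h | h
  · left
    rw [secondHighest, h, sup_empty]
    rfl
  · right
    obtain ⟨q, hq, hs⟩ := exists_mem_eq_sup _ h fun q : Fin n × Fin n => min (x q.1) (x q.2)
    have hne : q.1 ≠ q.2 := (mem_offDiag.1 hq).2.2
    by_cases h₁ : q.1 = top
    · exact ⟨q.2, fun h₂ => hne (h₁.trans h₂.symm), hs.le.trans (min_le_right _ _)⟩
    · exact ⟨q.1, h₁, hs.le.trans (min_le_left _ _)⟩

theorem support_eq {m : ℕ} (s : Scheme m) (S : ℕ) :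
    support s S = univ.filter fun j => s j = S := by
  ext j
  simp [support, phi]

namespace Instance

variable (I : Instance)

/-- The part of the expected value of bidder `i` that comes from the support of `S`. -/
def mass (s : Scheme I.m) (S : ℕ) (i : Fin I.n) : NNRat := ∑ j with s j = S, I.p j * I.v i j

/-- If the signal has probability zero, the posterior is a quotient by zero, but then each `p j *
phi s j S` vanishes and both sides are zero. -/
theorem signalProb_mul_expectedValue (s : Scheme I.m) (S : ℕ) (i : Fin I.n) :
    I.signalProb s S * I.expectedValue s S i = I.mass s S i := by
  have h : ∀ j, I.signalProb s S * I.posterior s S j = I.p j * phi s j S := by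
    intro j
    by_cases h₀ : I.signalProb s S = 0
    · rw [h₀, zero_mul]
      exact (sum_eq_zero_iff.1 h₀ j (mem_univ j)).symm
    · rw [posterior, mul_div_cancel₀ _ h₀]
  simp only [expectedValue, mul_sum, ← mul_assoc, h, mass, sum_filter, phi, mul_ite, mul_one,
    mul_zero, ite_mul, zero_mul]

theorem revenue_eq (s : Scheme I.m) :
    I.revenue s = ∑ S ∈ univ.image s, secondHighest (I.mass s S) :=
  sum_congr rfl fun S _ => by
    rw [secondHighest_mul]
    simp only [signalProb_mul_expectedValue]

theorem m_pos : 0 < I.m := by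
  by_contra h
  have h₀ := I.p_sum
  rw [sum_eq_zero fun j _ => absurd j.2 (by omega)] at h₀
  exact zero_ne_one h₀

end Instance

/-! ### Comparison of the integer data with the revenue -/

theorem card_filter_fin {m : ℕ} (f : ℕ → ℕ) (g : ℕ) :
    #{j : Fin m | f j = g} = #{j ∈ range m | f j = g} := by
  rw [card_filter, card_filter, sum_range]

theorem sum_filter_fin {m : ℕ} (f x : ℕ → ℕ) (g : ℕ) :
    ∑ j ∈ univ.filter fun j : Fin m => f j = g, x j = ∑ j ∈ range m with f j = g, x j := by
  rw [sum_filter, sum_filter, sum_range]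

/-- A scaled instance with anonymity parameter `K`, in natural numbers. -/
structure Scaled (I : Instance) (D K : ℕ) (w : ℕ → ℕ → ℕ) (V : ℕ → ℕ) : Prop where
  pos : 0 < D
  anonymity : I.K + (1 - I.K) = K
  weight : ∀ (i : Fin I.n) (j : Fin I.m), (w i j : NNRat) = D * (I.p j * I.v i j)
  total : ∀ i < I.n, V i = ∑ j ∈ range I.m, w i j

namespace Scaled

variable {I : Instance} {D K : ℕ} {w : ℕ → ℕ → ℕ} {V : ℕ → ℕ} (H : Scaled I D K w V)
include H

theorem mul_mass (s : Scheme I.m) (S : ℕ) (i : Fin I.n) :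
    D * I.mass s S i = ((∑ j : Fin I.m with s j = S, w i j : ℕ) : NNRat) := by
  rw [Instance.mass, mul_sum, Nat.cast_sum]
  exact sum_congr rfl fun j _ => (H.weight i j).symm

theorem anonymity_pos : 1 ≤ K := by
  have := H.anonymity
  omega

theorem le_anonymity : I.K ≤ K := by
  have := H.anonymity
  omega

theorem anonymity_le : K ≤ I.m := by
  have := H.anonymity
  have := I.K_le
  have := I.m_pos
  omega

/-- The supports are disjoint and each has at least `K` elements. Here `K` is the maximum of `I.K`
and `1`, which is legitimate since a signal in use has a nonempty support. -/
theorem card_signals_le {s : Scheme I.m} (hs : IsKAnonymous I.K s) :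
    #(univ.image s) ≤ I.m / K := by
  rw [Nat.le_div_iff_mul_le H.anonymity_pos]
  have h := card_eq_sum_card_image s univ
  rw [card_univ, Fintype.card_fin] at h
  rw [← smul_eq_mul]
  refine le_trans (card_nsmul_le_sum _ _ _ fun S hS => ?_) h.ge
  obtain ⟨j, -, hj⟩ := mem_image.1 hS
  have hne : (support s S).Nonempty := ⟨j, by simp [support_eq, hj]⟩
  have h₁ := hs S hne
  have h₂ := hne.card_pos
  rw [support_eq] at h₁ h₂
  have := H.anonymity
  omega

/-- The revenue of any scheme is bounded by an assignment of the categories to few bidders other than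
the first one. -/
theorem exists_revenue_le (hn : 0 < I.n) {s : Scheme I.m} (hs : IsKAnonymous I.K s) :
    ∃ a : ℕ → ℕ, (∀ j < I.m, a j < I.n) ∧ #((range I.m).image a) ≤ I.m / K ∧
      (D * I.revenue s : NNRat) ≤ ((∑ j ∈ range I.m,
        w (a j) j * if 0 < rank (range I.n) V (a j) then 1 else 0 : ℕ) : NNRat) := by
  obtain ⟨top, htop, hr⟩ := exists_rank_eq (A := range I.n) (key := V) (k := 0) (by simpa using hn)
  have key : ∀ S, ∃ i : Fin I.n, D * secondHighest (I.mass s S) ≤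
      ((∑ j : Fin I.m with s j = S,
        w i j * if 0 < rank (range I.n) V i then 1 else 0 : ℕ) : NNRat) := by
    intro S
    rcases exists_secondHighest_le (I.mass s S) ⟨top, mem_range.1 htop⟩ with h | ⟨i, hi, h⟩
    · exact ⟨⟨0, hn⟩, by rw [h, mul_zero]; exact zero_le⟩
    · refine ⟨i, (mul_le_mul_right h _).trans ?_⟩
      have : 0 < rank (range I.n) V i := by
        rw [Nat.pos_iff_ne_zero]
        intro h₀
        exact hi (Fin.ext (rank_injOn (by simp) htop (h₀.trans hr.symm)))
      simp only [this, if_true, mul_one]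
      exact (H.mul_mass s S i).le
  choose b hb using key
  -- Each category goes to the bidder chosen for its signal, so the number of bidders used is at
  -- most the number of signals.
  refine ⟨fun j => if h : j < I.m then b (s ⟨j, h⟩) else 0, fun j hj => ?_, ?_, ?_⟩
  · simp [hj]
  · refine (card_le_card (t := (univ.image s).image fun S => (b S : ℕ)) fun i hi => ?_).trans
      (card_image_le.trans (H.card_signals_le hs))
    obtain ⟨j, hj, rfl⟩ := mem_image.1 hi
    have hj := mem_range.1 hj
    simp only [hj, dif_pos]
    exact mem_image_of_mem (fun S => (b S : ℕ)) (mem_image_of_mem _ (mem_univ _))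
  · rw [I.revenue_eq, mul_sum, sum_range]
    refine (sum_le_sum fun S _ => hb S).trans ?_
    rw [← Nat.cast_sum, Nat.cast_le]
    simp only [Fin.is_lt, dif_pos, Fin.eta]
    rw [← sum_fiberwise_of_maps_to (s := univ) (t := univ.image s) (g := s)
      (fun j _ => mem_image_of_mem _ (mem_univ j))]
    refine (sum_congr rfl fun S _ => sum_congr rfl fun j hj => ?_).le
    rw [(mem_filter.1 hj).2]

/-- The revenue of a single signal. -/
theorem le_revenue_const :
    ((∑ i ∈ range I.n, V i * (if rank (range I.n) V i = 1 then 1 else 0) : ℕ) : NNRat) ≤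
      D * I.revenue fun _ => 0 := by
  have hrev : I.revenue (fun _ => 0) = secondHighest (I.mass (fun _ => 0) 0) := by
    have : (univ : Finset (Fin I.m)).image (fun _ => (0 : ℕ)) = {0} :=
      image_const ⟨⟨0, I.m_pos⟩, mem_univ _⟩ 0
    rw [I.revenue_eq, this, sum_singleton]
  have hmass : ∀ i : Fin I.n, (D * I.mass (fun _ => 0) 0 i : NNRat) = (V i : ℕ) := fun i => by
    rw [H.mul_mass, H.total i i.2, sum_range]
    simp
  rw [hrev, secondHighest_mul]
  simp only [hmass]
  by_cases hn : 1 < I.n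
  · obtain ⟨i₀, h₀, r₀⟩ := exists_rank_eq (A := range I.n) (key := V) (k := 0) (by simp; omega)
    obtain ⟨i₁, h₁, r₁⟩ := exists_rank_eq (A := range I.n) (key := V) (k := 1) (by simpa using hn)
    have hsum := sum_mul_rank_eq (key := V) V h₁
    rw [r₁] at hsum
    rw [hsum]
    refine le_secondHighest (i := ⟨i₀, mem_range.1 h₀⟩) (i' := ⟨i₁, mem_range.1 h₁⟩) ?_ ?_ le_rfl
    · intro h
      obtain rfl : i₀ = i₁ := congrArg Fin.val h
      omega
    · exact Nat.cast_le.2 (key_le_of_rank_le h₁ (le_of_eq_of_le r₀ (Nat.zero_le _)))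
  · rw [sum_eq_zero]
    · exact zero_le
    · intro i hi
      have := rank_lt_card (key := V) hi
      rw [card_range] at this
      rw [if_neg (by omega), mul_zero]

/-- Without the first bidder, no bidder has a larger value than the second one. -/
theorem sum_le_second {i : ℕ} (hi : i < I.n) :
    ∑ j ∈ range I.m, (w i j * if 0 < rank (range I.n) V i then 1 else 0) ≤
      ∑ i ∈ range I.n, V i * (if rank (range I.n) V i = 1 then 1 else 0) := by
  by_cases h : 0 < rank (range I.n) V i
  · simp only [h, if_true, mul_one]
    have hlt := rank_lt_card (key := V) (mem_range.2 hi)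
    obtain ⟨i₁, h₁, r₁⟩ := exists_rank_eq (A := range I.n) (key := V) (k := 1) (by omega)
    have hsum := sum_mul_rank_eq (key := V) V h₁
    rw [r₁] at hsum
    rw [hsum, ← H.total i hi]
    exact key_le_of_rank_le (mem_range.2 hi) (by omega)
  · simp [h]

/-- The revenue of the groups. -/
theorem le_revenue_group (hn : 0 < I.n) {R Q : ℕ} (hR : I.m / K = R) (hQ : R / 2 = Q)
    {cur own : ℕ → ℕ}
    (hinv : GreedyInv I.m I.n R (fun i j => w i j * if 0 < rank (range I.n) V i then 1 else 0)
      R cur own) :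
    ((∑ j ∈ range I.m, cur j : ℕ) : NNRat) ≤
      ((∑ i ∈ range I.n, V i * (if rank (range I.n) V i = 1 then 1 else 0) : ℕ) : NNRat) +
        4 * (D * I.revenue fun j : Fin I.m => group I.m I.n K Q cur own j) := by
  have hR0 : R ≠ 0 := by
    have := Nat.div_pos H.anonymity_le H.anonymity_pos
    omega
  have hown : ∀ j < I.m, own j < I.n := fun j hj => (hinv.cur_eq hR0 j hj).1
  have hcur := fun j hj => (hinv.cur_eq hR0 j hj).2
  have hQK : 2 * Q * K ≤ I.m := by
    have h₁ : 2 * Q ≤ R := by omega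
    calc 2 * Q * K ≤ R * K := Nat.mul_le_mul_right _ h₁
      _ ≤ I.m := by rw [← hR]; exact Nat.div_mul_le_self _ _
  have hsum := sum_cur_le (Q := Q) (cur := cur) hown ((hinv.card_le hR0).trans (by omega))
  set u : ℕ → ℕ → ℕ := fun i j => w i j * if 0 < rank (range I.n) V i then 1 else 0 with hu
  have huw : ∀ i j, u i j ≤ w i j := fun i j => by
    simp only [hu]
    split_ifs <;> simp
  set σ := sorted (range I.n) (share I.m cur own) with hσ
  -- A share is part of the bidder's total in the matrix without the top bidder, and no row of that
  -- matrix exceeds the second largest total.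
  have h₀ : σ 0 ≤ ∑ i ∈ range I.n, V i * (if rank (range I.n) V i = 1 then 1 else 0) := by
    obtain ⟨i, hi, hr⟩ := exists_rank_eq (A := range I.n) (key := share I.m cur own) (k := 0)
      (by simpa using hn)
    have hσ₀ : σ 0 = share I.m cur own i := by rw [hσ, ← hr, sorted_rank hi]
    rw [hσ₀]
    refine le_trans ?_ (H.sum_le_second (mem_range.1 hi))
    refine (sum_le_sum (g := u i) fun j hj => ?_).trans
      (sum_le_sum_of_subset (filter_subset _ _))
    obtain ⟨hjm, rfl⟩ := mem_filter.1 hj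
    exact (hcur j (mem_range.1 hjm)).le
  set s : Scheme I.m := fun j : Fin I.m => group I.m I.n K Q cur own j with hs
  -- Both members of pair `g` have shares at least `σ (2 * g + 1)` and bid at least half of them, so
  -- the second highest bid does too.
  have hg : ∀ g < Q, (σ (2 * g + 1) : NNRat) ≤ 2 * (D * secondHighest (I.mass s g)) := by
    intro g hg
    by_cases hlt : 2 * g + 1 < I.n
    · obtain ⟨i₀, hi₀, r₀⟩ := exists_rank_eq (A := range I.n) (key := share I.m cur own)
        (k := 2 * g) (by rw [card_range]; omega)
      obtain ⟨i₁, hi₁, r₁⟩ := exists_rank_eq (A := range I.n) (key := share I.m cur own)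
        (k := 2 * g + 1) (by rw [card_range]; omega)
      have hbound : ∀ i (hi : i < I.n), rank (range I.n) (share I.m cur own) i / 2 = g →
          (share I.m cur own i : NNRat) ≤ 2 * (D * I.mass s g ⟨i, hi⟩) := by
        intro i hi hr
        rw [H.mul_mass, hs]
        dsimp only
        rw [sum_filter_fin]
        have h₁ := share_le_two_mul_sum_group (K := K) (u := u) hcur hg hr
        have h₂ : ∑ j ∈ range I.m with group I.m I.n K Q cur own j = g, u i j ≤
            ∑ j ∈ range I.m with group I.m I.n K Q cur own j = g, w i j :=
          sum_le_sum fun j _ => huw i j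
        exact_mod_cast h₁.trans (Nat.mul_le_mul_left 2 h₂)
      rw [hσ, ← r₁, sorted_rank hi₁, secondHighest_mul, secondHighest_mul]
      refine le_secondHighest (i := ⟨i₀, mem_range.1 hi₀⟩) (i' := ⟨i₁, mem_range.1 hi₁⟩) ?_ ?_
        (hbound _ _ (by omega))
      · intro h
        obtain rfl : i₀ = i₁ := congrArg Fin.val h
        omega
      · exact (Nat.cast_le.2 (key_le_of_rank_le hi₁ (by omega))).trans
          (hbound _ (mem_range.1 hi₀) (by omega))
    · rw [hσ, sorted_eq_zero (by rw [card_range]; omega), Nat.cast_zero]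
      exact zero_le
  have hrev : ∑ g ∈ range Q, secondHighest (I.mass s g) ≤ I.revenue s := by
    rw [I.revenue_eq]
    refine sum_le_sum_of_subset fun g hgQ => ?_
    have h₁ := le_card_group (cur := cur) hown H.anonymity_pos hQK (mem_range.1 hgQ)
    have h₂ : 0 < #{j ∈ range I.m | group I.m I.n K Q cur own j = g} :=
      (H.anonymity_pos).trans h₁
    obtain ⟨j, hj⟩ := card_pos.1 h₂
    obtain ⟨hj, hjg⟩ := mem_filter.1 hj
    exact mem_image.2 ⟨⟨j, mem_range.1 hj⟩, mem_univ _, hjg⟩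
  calc ((∑ j ∈ range I.m, cur j : ℕ) : NNRat)
      ≤ ((σ 0 + 2 * ∑ g ∈ range Q, σ (2 * g + 1) : ℕ) : NNRat) := Nat.cast_le.2 hsum
    _ = (σ 0 : NNRat) + 2 * ∑ g ∈ range Q, (σ (2 * g + 1) : NNRat) := by push_cast; rfl
    _ ≤ (σ 0 : NNRat) + 2 * ∑ g ∈ range Q, 2 * (D * secondHighest (I.mass s g)) := by
        gcongr with g hgQ
        exact hg g (mem_range.1 hgQ)
    _ = (σ 0 : NNRat) + 4 * (D * ∑ g ∈ range Q, secondHighest (I.mass s g)) := by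
        rw [← mul_sum, ← mul_sum]; ring
    _ ≤ _ := by gcongr

theorem group_anonymous {R Q : ℕ} (hR : I.m / K = R) (hQ : R / 2 = Q) {cur own : ℕ → ℕ}
    (hown : ∀ j < I.m, own j < I.n) :
    IsKAnonymous I.K fun j : Fin I.m => group I.m I.n K Q cur own j := by
  intro S hS
  rw [support_eq, card_filter_fin]
  -- Without pairs nothing is kept and every category falls into group `0`, which is the scheme with
  -- a single signal.
  rcases Nat.eq_zero_or_pos Q with h₀ | h₀
  · have hz : ∀ j, group I.m I.n K Q cur own j = 0 := fun j => by
      rw [group, if_neg fun h => by have := h.2; omega, if_neg (by omega)]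
    obtain ⟨j, hj⟩ := hS
    rw [support_eq, mem_filter, hz] at hj
    simp only [hz, hj.2, filter_true, card_range]
    exact I.K_le
  · have hQK : 2 * Q * K ≤ I.m := by
      have h₁ : 2 * Q ≤ R := by omega
      calc 2 * Q * K ≤ R * K := Nat.mul_le_mul_right _ h₁
        _ ≤ I.m := by rw [← hR]; exact Nat.div_mul_le_self _ _
    obtain ⟨j, hj⟩ := hS
    rw [support_eq, mem_filter] at hj
    refine H.le_anonymity.trans (le_card_group hown H.anonymity_pos hQK ?_)
    rw [← hj.2]
    exact group_lt h₀

end Scaled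

/-! ### The encoding -/

theorem getElem?_flatMap_of_length {α : Type*} {l : List α} {F : α → List ℕ} {c : ℕ}
    (hF : ∀ a, (F a).length = c) {i j : ℕ} (hj : j < c) {a : α} (hi : l[i]? = some a) :
    (l.flatMap F)[i * c + j]? = (F a)[j]? := by
  induction l generalizing i with
  | nil => simp at hi
  | cons b l ih =>
    rw [List.flatMap_cons]
    cases i with
    | zero =>
      simp only [List.getElem?_cons_zero, Option.some.injEq] at hi
      rw [zero_mul, zero_add, List.getElem?_append_left (by rw [hF]; exact hj), hi]
    | succ i =>
      rw [List.getElem?_cons_succ] at hi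
      rw [List.getElem?_append_right (by rw [hF, add_mul]; omega), hF,
        ← ih hi]
      congr 1
      rw [add_mul]
      omega

theorem length_flatMap_of_length {α : Type*} {l : List α} {F : α → List ℕ} {c : ℕ}
    (hF : ∀ a, (F a).length = c) : (l.flatMap F).length = l.length * c := by
  simp [List.length_flatMap, hF]

theorem finRange_getElem? {m : ℕ} (j : Fin m) : (List.finRange m)[(j : ℕ)]? = some j := by
  rw [List.getElem?_eq_getElem (by simp)]
  simp

theorem length_le_inputSize (x : List ℕ) : x.length ≤ inputSize x := by
  induction x with
  | nil => simp
  | cons a x ih =>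
    simp only [inputSize, List.map_cons, List.sum_cons, List.length_cons] at *
    omega

namespace Instance

variable (I : Instance)

/-- The initial memory. -/
def memory : Memory := (initialState I.encode []).mem

theorem memory_input (k : ℕ) : I.memory 0 k = (I.encode[k]?).getD 0 := by
  simp [memory, initialState]

theorem memory_m : I.memory 0 0 = I.m := by simp [memory_input, encode]
theorem memory_n : I.memory 0 1 = I.n := by simp [memory_input, encode]
theorem memory_K : I.memory 0 2 = I.K := by simp [memory_input, encode]

theorem length_encode_priors :
    ((List.finRange I.m).flatMap (fun j => [(I.p j).num, (I.p j).den])).length = I.m * 2 := by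
  rw [length_flatMap_of_length (c := 2) fun _ => rfl, List.length_finRange]

theorem length_encode_row (i : Fin I.n) :
    ((List.finRange I.m).flatMap (fun j => [(I.v i j).num, (I.v i j).den])).length = I.m * 2 := by
  rw [length_flatMap_of_length (c := 2) fun _ => rfl, List.length_finRange]

theorem memory_prior (j : Fin I.m) {b : ℕ} (hb : b < 2) :
    I.memory 0 (3 + b + (j + j)) = [(I.p j).num, (I.p j).den][b] := by
  have hj := j.2
  have h := getElem?_flatMap_of_length (F := fun j => [(I.p j).num, (I.p j).den]) (c := 2)
    (fun _ => rfl) hb (finRange_getElem? j)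
  rw [memory_input, encode, List.getElem?_append_left, List.getElem?_append_right,
    show 3 + b + ((j : ℕ) + j) - [I.m, I.n, I.K].length = j * 2 + b by simp; omega, h]
  · interval_cases b <;> rfl
  · simp; omega
  · rw [List.length_append, length_encode_priors]
    simp; omega

theorem memory_value (i : Fin I.n) (j : Fin I.m) {b : ℕ} (hb : b < 2) :
    I.memory 0 (3 + b + (I.m + (i * I.m + j) + (I.m + (i * I.m + j)))) =
      [(I.v i j).num, (I.v i j).den][b] := by
  have hj := j.2
  have h₁ := getElem?_flatMap_of_length
    (F := fun i => (List.finRange I.m).flatMap (fun j => [(I.v i j).num, (I.v i j).den]))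
    (c := I.m * 2) (j := j * 2 + b) I.length_encode_row (by omega) (finRange_getElem? i)
  have h₂ := getElem?_flatMap_of_length (F := fun j => [(I.v i j).num, (I.v i j).den]) (c := 2)
    (fun _ => rfl) hb (finRange_getElem? j)
  have h₃ : (i : ℕ) * (I.m * 2) = i * I.m + i * I.m := by ring
  rw [memory_input, encode, List.getElem?_append_right, List.length_append, length_encode_priors,
    show 3 + b + (I.m + (i * I.m + j) + (I.m + (i * I.m + j))) -
      ([I.m, I.n, I.K].length + I.m * 2) = i * (I.m * 2) + (j * 2 + b) by
        simp only [List.length_cons, List.length_nil]; omega, h₁, h₂]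
  · interval_cases b <;> rfl
  · rw [List.length_append, length_encode_priors]
    simp only [List.length_cons, List.length_nil]; omega

theorem scale_memory_le : scale I.memory ≤ inputSize I.encode := by
  refine le_trans ?_ (length_le_inputSize _)
  rw [encode, List.length_append, List.length_append, length_encode_priors,
    length_flatMap_of_length (c := I.m * 2) I.length_encode_row, List.length_finRange, scale,
    memory_m, memory_n]
  have h := I.m_pos
  have h₁ : I.n ≤ I.n * I.m := Nat.le_mul_of_pos_right _ h
  have h₂ : I.n * (I.m * 2) = I.n * I.m + I.n * I.m := by ring
  simp only [List.length_cons, List.length_nil]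
  omega

/-! ### Integer weights and the approximation guarantee -/

/-- The product of all denominators. -/
def denom : ℕ := ∏ t ∈ range (I.m + I.n * I.m), I.memory 0 (4 + (t + t))

/-- The scaled values, as the program computes them. -/
def weight (i j : ℕ) : ℕ :=
  I.denom / I.memory 0 (4 + (j + j)) /
    I.memory 0 (4 + (I.m + (i * I.m + j) + (I.m + (i * I.m + j)))) * I.memory 0 (3 + (j + j)) *
    I.memory 0 (3 + (I.m + (i * I.m + j) + (I.m + (i * I.m + j))))

theorem denom_pos : 0 < I.denom := by
  refine prod_pos fun t ht => ?_
  rw [mem_range] at ht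
  by_cases h : t < I.m
  · have := I.memory_prior ⟨t, h⟩ one_lt_two
    rw [show 4 + (t + t) = 3 + 1 + (t + t) from rfl, this]
    exact (I.p _).den_pos
  · have hm := I.m_pos
    have hi : (t - I.m) / I.m < I.n := by
      rw [Nat.div_lt_iff_lt_mul hm]
      omega
    have := I.memory_value ⟨_, hi⟩ ⟨(t - I.m) % I.m, Nat.mod_lt _ hm⟩ one_lt_two
    -- A position `t` beyond the priors is that of the value with bidder `(t - m) / m` and category
    -- `(t - m) % m`.
    have e : I.m + ((t - I.m) / I.m * I.m + (t - I.m) % I.m) = t := by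
      rw [Nat.div_add_mod']
      omega
    dsimp only at this
    rw [e] at this
    rw [show 4 + (t + t) = 3 + 1 + (t + t) from rfl, this]
    exact (I.v _ _).den_pos

/-- The denominators of `p j` and `v i j` sit at different positions of the product, so their own
product divides it and the truncated divisions are exact. -/
theorem weight_eq (i : Fin I.n) (j : Fin I.m) :
    (I.weight i j : NNRat) = I.denom * (I.p j * I.v i j) := by
  have hj := j.2
  have hlt : I.m + (i * I.m + j) < I.m + I.n * I.m := by
    have : (i + 1) * I.m ≤ I.n * I.m := Nat.mul_le_mul_right _ i.2
    rw [add_mul] at this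
    omega
  have hsub : ({(j : ℕ), I.m + (i * I.m + j)} : Finset ℕ) ⊆ range (I.m + I.n * I.m) := by
    intro t ht
    simp only [mem_insert, mem_singleton] at ht
    rw [mem_range]
    omega
  have hdvd := prod_dvd_prod_of_subset _ _ (fun t => I.memory 0 (4 + (t + t))) hsub
  rw [prod_pair (by omega)] at hdvd
  have p₀ : I.memory 0 (3 + (j + j)) = (I.p j).num := I.memory_prior j two_pos
  have p₁ : I.memory 0 (4 + (j + j)) = (I.p j).den := I.memory_prior j one_lt_two
  have v₀ : I.memory 0 (3 + (I.m + (i * I.m + j) + (I.m + (i * I.m + j)))) = (I.v i j).num :=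
    I.memory_value i j two_pos
  have v₁ : I.memory 0 (4 + (I.m + (i * I.m + j) + (I.m + (i * I.m + j)))) = (I.v i j).den :=
    I.memory_value i j one_lt_two
  rw [p₁, v₁] at hdvd
  change (I.p j).den * (I.v i j).den ∣ I.denom at hdvd
  rw [weight, p₀, p₁, v₀, v₁, Nat.div_div_eq_div_mul]
  obtain ⟨c, hc⟩ := hdvd
  have hp : ((I.p j).num : NNRat) = I.p j * (I.p j).den := (NNRat.mul_den_eq_num _).symm
  have hv : ((I.v i j).num : NNRat) = I.v i j * (I.v i j).den := (NNRat.mul_den_eq_num _).symm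
  rw [hc, Nat.mul_div_cancel_left _ (Nat.mul_pos (I.p j).den_pos (I.v i j).den_pos)]
  push_cast
  rw [hp, hv]
  ring

theorem scaled : Scaled I I.denom (I.K + (1 - I.K)) I.weight
    (fun i => ∑ j ∈ range I.m, I.weight i j) where
  pos := I.denom_pos
  anonymity := rfl
  weight := I.weight_eq
  total _ _ := rfl

/-- The program computes a scheme of large revenue. -/
theorem effect_isKAnonymous_and_le :
    IsKAnonymous I.K (fun j : Fin I.m => Algorithm.effect I.memory 1 j) ∧
    ∀ s : Scheme I.m, IsKAnonymous I.K s → (1 - (Real.exp 1)⁻¹) * (I.revenue s : ℝ) ≤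
      5 * (I.revenue fun j => Algorithm.effect I.memory 1 j : ℝ) := by
  set K := I.K + (1 - I.K) with hK
  have H := I.scaled
  set V : ℕ → ℕ := fun i => ∑ j ∈ range I.m, I.weight i j with hV
  have hR0 : I.m / K ≠ 0 := (Nat.div_pos H.anonymity_le H.anonymity_pos).ne'
  obtain ⟨cur, own, hinv, hout⟩ := Algorithm.effect_spec (R := I.m / K) I.memory_m I.memory_n
    (by rw [I.memory_K]) rfl hR0 rfl (by funext k; simp [memory, initialState]) (D := I.denom) rfl
    (w := I.weight) (fun _ _ _ _ => rfl) (V := V) (fun _ _ => rfl)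
  set sec : ℕ := ∑ i ∈ range I.n, V i * (if rank (range I.n) V i = 1 then 1 else 0) with hsec
  have hD : (0 : ℝ) < I.denom := Nat.cast_pos.2 H.pos
  -- the greedy algorithm bounds the revenue of all schemes
  have hgreedy : 0 < I.n → ∀ s : Scheme I.m, IsKAnonymous I.K s →
      (1 - (Real.exp 1)⁻¹) * (I.denom * (I.revenue s : ℝ)) ≤ ∑ j ∈ range I.m, (cur j : ℝ) := by
    intro hn s hs
    obtain ⟨a, ha, hcard, hle⟩ := H.exists_revenue_le hn hs
    refine le_trans ?_ ((hinv hn).exp_approx hR0 a ha hcard)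
    have he : 0 ≤ 1 - (Real.exp 1)⁻¹ := by
      rw [sub_nonneg]
      exact inv_le_one_of_one_le₀ (Real.one_le_exp zero_le_one)
    refine mul_le_mul_of_nonneg_left ?_ he
    exact_mod_cast hle
  -- The threshold `5` balances the cases: from `G ≤ sec + 4 * Rev`, a small `sec` leaves `4 / 5` of
  -- `G` for `4 * Rev`, while a large `sec` is itself at least `G / 5`.
  by_cases hcase : 0 < I.n ∧ 5 * sec < ∑ j ∈ range I.m, cur j
  · have hscheme : (fun j : Fin I.m => Algorithm.effect I.memory 1 j) =
        fun j : Fin I.m => group I.m I.n K (I.m / K / 2) cur own j := by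
      funext j
      rw [hout j j.2, if_pos hcase]
    rw [hscheme]
    refine ⟨H.group_anonymous rfl rfl fun j hj => ((hinv hcase.1).cur_eq hR0 j hj).1,
      fun s hs => ?_⟩
    have h₁ := hgreedy hcase.1 s hs
    have h₂ := H.le_revenue_group hcase.1 rfl rfl (hinv hcase.1)
    have h₃ : ∑ j ∈ range I.m, (cur j : ℝ) ≤ sec + 4 * (I.denom *
        (I.revenue fun j : Fin I.m => group I.m I.n K (I.m / K / 2) cur own j : ℝ)) := by
      exact_mod_cast h₂
    have h₄ : 5 * (sec : ℝ) ≤ ∑ j ∈ range I.m, (cur j : ℝ) := by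
      exact_mod_cast hcase.2.le
    refine le_of_mul_le_mul_left ?_ hD
    linarith
  · have hscheme : (fun j : Fin I.m => Algorithm.effect I.memory 1 j) = fun _ => 0 := by
      funext j
      rw [hout j j.2, if_neg hcase]
    rw [hscheme]
    refine ⟨fun S hS => ?_, fun s hs => ?_⟩
    · obtain ⟨j, hj⟩ := hS
      rw [support_eq, mem_filter] at hj
      simp only [support_eq, hj.2, filter_true, card_univ, Fintype.card_fin]
      exact I.K_le
    · rcases Nat.eq_zero_or_pos I.n with hn | hn
      · have h₀ : I.revenue s = 0 := by
          rw [revenue_eq]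
          refine sum_eq_zero fun S _ => ?_
          have : (univ : Finset (Fin I.n)).offDiag = ∅ :=
            eq_empty_of_forall_notMem fun q _ => absurd q.1.2 (by omega)
          rw [secondHighest, this]
          rfl
        rw [h₀]
        simp only [NNRat.cast_zero, mul_zero]
        exact mul_nonneg (by norm_num) (NNRat.cast_nonneg _)
      · have h₁ := hgreedy hn s hs
        have h₂ := H.le_revenue_const
        have h₃ : (sec : ℝ) ≤ I.denom * (I.revenue fun _ => 0 : ℝ) := by exact_mod_cast h₂
        have h₄ : ∑ j ∈ range I.m, (cur j : ℝ) ≤ 5 * (sec : ℝ) := by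
          exact_mod_cast not_lt.1 fun h => hcase ⟨hn, h⟩
        refine le_of_mul_le_mul_left ?_ hD
        linarith

end Instance

theorem coinExpectation_const {N : ℕ} (x : ℝ) : coinExpectation (fun _ : Fin N → Bool => x) = x := by
  rw [coinExpectation, sum_const, card_univ, Fintype.card_fun, Fintype.card_bool, Fintype.card_fin,
    nsmul_eq_mul]
  push_cast
  field_simp

end KAnonSignaling

/-- No coin is used, so the same bound holds for every outcome of the tosses. The guarantee has
constant `5`, which is weakened to `6` since revenues are nonnegative. -/
theorem mainTheorem5 :
    ∃ P : KAnonSignaling.Program,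
      KAnonSignaling.IsRandomizedPolyTimeRevenueApprox
        (6 * Real.exp 1 / (Real.exp 1 - 1)) P := by
  obtain ⟨T, hT⟩ := KAnonSignaling.Algorithm.program_computes.haltsWithin
    KAnonSignaling.Algorithm.program_safe .X
  refine ⟨KAnonSignaling.Algorithm.program, T, fun I =>
    ⟨fun _ => KAnonSignaling.Algorithm.effect I.memory 1,
      fun r => hT I.encode (by rw [Polynomial.eval_X]; exact I.scale_memory_le) r,
      fun _ => I.effect_isKAnonymous_and_le.1, fun s hs => ?_⟩⟩
  rw [KAnonSignaling.coinExpectation_const]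
  have h := I.effect_isKAnonymous_and_le.2 s hs
  have he : 1 < Real.exp 1 := Real.one_lt_exp_iff.2 one_pos
  have hpos : 0 < Real.exp 1 - 1 := sub_pos.2 he
  set x : ℝ := (I.revenue s : ℝ)
  set y : ℝ := (I.revenue fun j => KAnonSignaling.Algorithm.effect I.memory 1 j : ℝ) with hy
  have hy0 : 0 ≤ y := NNRat.cast_nonneg _
  have h' : (Real.exp 1 - 1) * x ≤ 5 * Real.exp 1 * y := by
    have := mul_le_mul_of_nonneg_left h (Real.exp_pos 1).le
    have e : Real.exp 1 * ((1 - (Real.exp 1)⁻¹) * x) = (Real.exp 1 - 1) * x := by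
      field_simp
    linarith
  rw [div_mul_eq_mul_div, le_div_iff₀ hpos]
  have : 0 ≤ Real.exp 1 * y := mul_nonneg (Real.exp_pos 1).le hy0
  linarith
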